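/- Let $d,n,k,\ell\ge 1$ be integers with $n=k\ell$, let $\delta\in(0,1/2)$ and $\theta\in\mathbf R^d$, and let $$Y_i=\eta_i\theta+\xi_i,\qquad i=1,\dots,n,$$ where $(\eta_i)$ is a homogeneous symmetric Markov chain on $\{-1,1\}$ with flip probability $\delta$ ($\eta_1$ is Rademacher and, given the past, $\eta_{i+1}=-\eta_i$ with probability $\delta$ and $\eta_{i+1}=\eta_i$ with probability $1-\delta$), and $\xi_1,\dots,\xi_n$ are i.i.d. random vectors in $\mathbf R^d$, independent of $\eta$, which are isotropic ($\mathbf E[\xi_i\xi_i^\top]=\mathbf I_d$) and $1$-sub-Gaussian ($\mathbf E\,e^{\langle v,\xi_i\rangle}\le e^{\|v\|^2/2}$ for all $v\in\mathbf R^d$). Split $\{1,\dots,n\}$ into $\ell$ consecutive buckets $I_1,\dots,I_\ell$ of length $k$ and put $$\tilde Y_i=\frac1k\sum_{j\in I_i}Y_j,\qquad \bar\eta_i=\frac1k\sum_{j\in I_i}\eta_j,\qquad \bar\eta=(\bar\eta_1,\dots,\bar\eta_\ell),\qquad \hat\Sigma=\frac1\ell\tilde Y\tilde Y^\top,$$ where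 $\tilde Y\in\mathbf R^{d\times\ell}$ has columns $\tilde Y_1,\dots,\tilde Y_\ell$. Let $\lambda_{\max}(\hat\Sigma)$ be the largest eigenvalue of $\hat\Sigma$ and $v_{\max}(\hat\Sigma)$ a corresponding unit eigenvector (any choice), and define $$\hat\theta(\ell)=\sqrt{\frac{\ell}{\mathbf E\|\bar\eta\|^2}\Big(\lambda_{\max}(\hat\Sigma)-\frac1k\Big)_+}\;v_{\max}(\hat\Sigma),\qquad \ell(\tilde\theta,\theta)=\min\{\|\tilde\theta-\theta\|,\|\tilde\theta+\theta\|\}.$$ There are absolute constants $c_0,c_1,C>0$ such that, for all such $d,n,k,\ell,\delta,\theta$ and all such distributions of the noise, the following hold. (i) If $0<\|\theta\|^2\le1$, then with probability at least $1-c_1e^{-c_0d}$ $$\ell(\hat\theta(\ell),\theta)\le C\,\frac{\ell}{\mathbf E\|\bar\eta\|^2}\left(\sqrt{\frac d\ell}\,\|\theta\|+\sqrt{\frac dn}+\frac1{\|\theta\|}\Big(\sqrt{\frac d{kn}}+\frac dn\Big)\right).$$ (ii) If $\|\theta\|^2\ge1$ and $\ell=n$ (so $k=1$), then with probability at least $1-c_1e^{-c_0d}$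 $$\ell(\hat\theta(n),\theta)\le C\left(\sqrt{\frac dn}+\frac dn\right).$$ -/

import Mathlib

open MeasureTheory ProbabilityTheory

noncomputable section

namespace HiddenMarkovMixture

variable {Ω : Type*} [MeasurableSpace Ω]

/-- `η 0, …, η (n - 1)` is a homogeneous binary symmetric Markov chain with flip probability `δ`:
the first sign is Rademacher and, given the whole past up to time `i`, the next sign is the
opposite of `η i` with probability `δ` (and hence equal to it with probability `1 - δ`). -/
structure IsSymmetricSignChain (μ : Measure Ω) (δ : ℝ) {n : ℕ} (η : Fin n → Ω → ℝ) : Prop where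
  measurable : ∀ i, Measurable (η i)
  sign : ∀ i ω, η i ω = 1 ∨ η i ω = -1
  initial : ∀ i : Fin n, (i : ℕ) = 0 →
    μ.real {ω | η i ω = 1} = 1 / 2 ∧ μ.real {ω | η i ω = -1} = 1 / 2
  transition : ∀ i j : Fin n, (j : ℕ) = (i : ℕ) + 1 → ∀ s : Fin n → ℝ,
    μ.real {ω | (∀ m ≤ i, η m ω = s m) ∧ η j ω = -η i ω} =
      δ * μ.real {ω | ∀ m ≤ i, η m ω = s m}

/-- A random vector is 1-(sub)Gaussian: `E exp ⟨v, ξ⟩ ≤ exp (‖v‖² / 2)` for every `v`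
(the expectation being finite). -/
def IsSubGaussianVector {d : ℕ} (μ : Measure Ω) (ξ : Ω → EuclideanSpace ℝ (Fin d)) : Prop :=
  ∀ v : EuclideanSpace ℝ (Fin d),
    Integrable (fun ω => Real.exp (inner ℝ v (ξ ω))) μ ∧
      ∫ ω, Real.exp (inner ℝ v (ξ ω)) ∂μ ≤ Real.exp (‖v‖ ^ 2 / 2)

/-- A random vector is isotropic: `E[ξ ξᵀ]` is the identity matrix. -/
def IsIsotropic {d : ℕ} (μ : Measure Ω) (ξ : Ω → EuclideanSpace ℝ (Fin d)) : Prop :=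
  ∀ a b : Fin d, ∫ ω, ξ ω a * ξ ω b ∂μ = if a = b then 1 else 0

/-- I.i.d. isotropic 1-(sub)Gaussian noise vectors. -/
structure IsNoise {d n : ℕ} (μ : Measure Ω) (ξ : Fin n → Ω → EuclideanSpace ℝ (Fin d)) :
    Prop where
  measurable : ∀ i, Measurable (ξ i)
  indep : iIndepFun ξ μ
  identDistrib : ∀ i j, IdentDistrib (ξ i) (ξ j) μ μ
  isotropic : ∀ i, IsIsotropic μ (ξ i)
  subGaussian : ∀ i, IsSubGaussianVector μ (ξ i)

/-- The hidden Markov sub-Gaussian mixture model `Y i = η i • θ + ξ i`, with the sign chain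
independent of the noise. -/
structure IsModel {d n : ℕ} (μ : Measure Ω) (δ : ℝ) (θ : EuclideanSpace ℝ (Fin d))
    (η : Fin n → Ω → ℝ) (ξ Y : Fin n → Ω → EuclideanSpace ℝ (Fin d)) : Prop where
  chain : IsSymmetricSignChain μ δ η
  noise : IsNoise μ ξ
  indep : IndepFun (fun ω i => η i ω) (fun ω i => ξ i ω) μ
  obs : ∀ i ω, Y i ω = η i ω • θ + ξ i ω

/-- The `i`-th bucket of `k` consecutive indices: those `j` with `i * k ≤ j < (i + 1) * k`. -/
def bucket (n k : ℕ) {l : ℕ} (i : Fin l) : Finset (Fin n) :=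
  {j | (i : ℕ) * k ≤ (j : ℕ) ∧ (j : ℕ) < ((i : ℕ) + 1) * k}

/-- The mean over the `i`-th bucket (of length `k`). -/
def bucketMean {E : Type*} [AddCommGroup E] [Module ℝ E] {n : ℕ} (k : ℕ) {l : ℕ}
    (x : Fin n → E) (i : Fin l) : E :=
  (1 / (k : ℝ)) • ∑ j ∈ bucket n k i, x j

/-- `E ‖η̄‖²`, where `η̄` is the vector of the `l` bucket means of the signs. -/
def expectedEnergy (μ : Measure Ω) {n : ℕ} (k l : ℕ) (η : Fin n → Ω → ℝ) : ℝ :=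
  ∫ ω, ∑ i : Fin l, (bucketMean k (fun j => η j ω) i) ^ 2 ∂μ

/-- The `d × l` matrix whose columns are the bucket means of the data. -/
def bucketMatrix {d n : ℕ} (k l : ℕ) (y : Fin n → EuclideanSpace ℝ (Fin d)) :
    Matrix (Fin d) (Fin l) ℝ :=
  Matrix.of fun a i => bucketMean k y i a

/-- The matrix `Σ̂ = (1 / l) Ỹ Ỹᵀ`. -/
def sampleCov {d n : ℕ} (k l : ℕ) (y : Fin n → EuclideanSpace ℝ (Fin d)) :
    Matrix (Fin d) (Fin d) ℝ :=
  (1 / (l : ℝ)) • (bucketMatrix k l y * (bucketMatrix k l y).transpose)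

/-- The largest (real) eigenvalue. -/
def lambdaMax {d : ℕ} (A : Matrix (Fin d) (Fin d) ℝ) : ℝ :=
  sSup (spectrum ℝ A)

/-- `vmax` assigns to every symmetric matrix a unit eigenvector for its largest eigenvalue. -/
def IsTopEigenvectorMap {d : ℕ}
    (vmax : Matrix (Fin d) (Fin d) ℝ → EuclideanSpace ℝ (Fin d)) : Prop :=
  ∀ A : Matrix (Fin d) (Fin d) ℝ, A.IsSymm →
    ‖vmax A‖ = 1 ∧ Matrix.toEuclideanLin A (vmax A) = lambdaMax A • vmax A

/-- The spectral estimator with `l` buckets of length `k`, as a function of the data `y`;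
`m` is the (known) value of `E ‖η̄‖²`. -/
def thetaHat {d n : ℕ} (vmax : Matrix (Fin d) (Fin d) ℝ → EuclideanSpace ℝ (Fin d))
    (k l : ℕ) (m : ℝ) (y : Fin n → EuclideanSpace ℝ (Fin d)) : EuclideanSpace ℝ (Fin d) :=
  √((l : ℝ) / m * max (lambdaMax (sampleCov k l y) - 1 / (k : ℝ)) 0) • vmax (sampleCov k l y)

/-- The sign-invariant loss. -/
def loss {d : ℕ} (a b : EuclideanSpace ℝ (Fin d)) : ℝ :=
  min ‖a - b‖ ‖a + b‖

end HiddenMarkovMixture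

end

open scoped RealInnerProductSpace

/-! Write `S i` for the noise summed over a bucket and divided by `√k`. These vectors are again
independent, isotropic and 1-sub-Gaussian, and the bucket means of the data are `η̄ᵢ θ + k^(-1/2)
Sᵢ`. With `m = E‖η̄‖²` and `g = ∑ η̄ᵢ Sᵢ`, expanding gives `Σ̂ - (1/k) I - (m/l) θθᵀ = (1/l) ((∑
η̄ᵢ² - m) θθᵀ + k^(-1/2) (θgᵀ + gθᵀ) + (1/k) (∑ SᵢSᵢᵀ - l I))`.

Outside an event of probability at most `4 exp(-2d)` the three fluctuations are at most `√(dl)`,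
`8√(dl)` and `320(√(dl) + d)` (`IsModel.measure_bad_event_le`). For the covariance this is Bernstein
plus a union over a net. For `g`, condition on the signs, which are independent of the noise. For
the energy, `η̄ᵢ²` depends only on the flips inside bucket `i`; flips of the chain are independent,
so Hoeffding applies.

The rest is deterministic (`min_norm_sub_norm_add_le`): an operator within `ε` of `s θθᵀ` has a
rescaled top eigenvector within `10ε / (s‖θ‖)` of `±θ`. This follows directly from the eigenvector
equation and the Rayleigh quotient at `θ`. For buckets of length one the energy is constant, so the
error term growing with `‖θ‖` disappears; this gives the strong signal case. -/

namespace HiddenMarkovMixture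

/-! ### Deterministic tools: perturbation of a rank-one operator, norming sets -/

/-- If `v` is a unit vector with `κ v ≈ s ⟪θ, v⟫ θ` and `κ` is not much smaller than `s ‖θ‖ ^ 2`,
then `√(κ₊ / s) v` is close to `θ` or to `-θ`. -/
lemma min_norm_sub_norm_add_le {V : Type*} [NormedAddCommGroup V] [InnerProductSpace ℝ V]
    {θ v : V} {s κ ε : ℝ} (hs : 0 < s) (hθ : θ ≠ 0) (hv : ‖v‖ = 1) (hε : 0 ≤ ε)
    (h₁ : ‖κ • v - (s * ⟪θ, v⟫) • θ‖ ≤ ε) (h₂ : s * ‖θ‖ ^ 2 - ε ≤ κ) :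
    min ‖√(1 / s * max κ 0) • v - θ‖ ‖√(1 / s * max κ 0) • v + θ‖ ≤ 10 * ε / (s * ‖θ‖) := by
  wlog ha : 0 ≤ ⟪θ, v⟫ generalizing θ
  · have := @this (-θ) (neg_ne_zero.2 hθ) (by simpa [inner_neg_left] using h₁) (by simpa using h₂)
      (by rw [inner_neg_left]; linarith)
    rwa [norm_neg, sub_neg_eq_add, ← sub_eq_add_neg, min_comm] at this
  refine (min_le_left _ _).trans ?_
  set a := ⟪θ, v⟫ with ha_def
  set t := ‖θ‖ with ht_def
  have ht : 0 < t := norm_pos_iff.2 hθ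
  have hat : a ≤ t := by simpa [hv] using real_inner_le_norm θ v
  have hst : 0 < s * t := by positivity
  -- Pair the approximate eigenvector equation with `v`.
  have hκ : |κ - s * a ^ 2| ≤ ε := by
    have h := abs_real_inner_le_norm (κ • v - (s * a) • θ) v
    rw [inner_sub_left, real_inner_smul_left, real_inner_smul_left, real_inner_self_eq_norm_sq, hv,
      ← ha_def] at h
    calc |κ - s * a ^ 2| = |κ * 1 ^ 2 - s * a * a| := by ring_nf
      _ ≤ _ := h
      _ ≤ ε := by simpa using h₁
  obtain ⟨hκ₁, hκ₂⟩ := abs_le.1 hκ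
  set ρ := √(1 / s * max κ 0) with hρ_def
  have hρ : 0 ≤ ρ := Real.sqrt_nonneg _
  have hρ2 : s * ρ ^ 2 = max κ 0 := by
    rw [hρ_def, Real.sq_sqrt (by positivity)]; field_simp
  have hat2 : s * a ^ 2 ≤ s * t ^ 2 := by gcongr
  rw [le_div_iff₀ hst]
  -- A signal below `4ε` says nothing about direction, but then the triangle inequality is enough:
  -- `6ε + 4ε`. Above it, `s a² ≥ s t² - 2ε ≥ s t² / 2`, so `v` is correlated with `θ`.
  rcases le_or_gt (s * t ^ 2) (4 * ε) with hc | hc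
  · have hn : ‖ρ • v - θ‖ ≤ ρ + t := by
      refine (norm_sub_le _ _).trans ?_
      rw [norm_smul, hv, Real.norm_of_nonneg hρ, mul_one]
    have h6 : s * ρ * t ≤ 6 * ε := by
      have : s * ρ ^ 2 ≤ s * t ^ 2 + ε := by
        rw [hρ2]; exact max_le (by linarith) (by positivity)
      nlinarith [mul_nonneg hs.le (sq_nonneg (ρ - t))]
    calc ‖ρ • v - θ‖ * (s * t) ≤ (ρ + t) * (s * t) := by gcongr
      _ = s * ρ * t + s * t ^ 2 := by ring
      _ ≤ 10 * ε := by linarith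
  · have hκ0 : 0 ≤ κ := by linarith
    rw [max_eq_left hκ0] at hρ2
    have ha2 : t ^ 2 ≤ 2 * a ^ 2 := by
      have : s * t ^ 2 ≤ s * (2 * a ^ 2) := by linarith
      exact le_of_mul_le_mul_left this hs
    have hat' : t ≤ 2 * a := by nlinarith
    have hρa : s * (ρ * |ρ - a|) ≤ ε := by
      have : ρ * |ρ - a| ≤ |ρ ^ 2 - a ^ 2| := by
        rw [show ρ ^ 2 - a ^ 2 = (ρ + a) * (ρ - a) by ring, abs_mul, abs_of_nonneg (add_nonneg hρ ha)]
        gcongr; linarith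
      calc s * (ρ * |ρ - a|) ≤ s * |ρ ^ 2 - a ^ 2| := by gcongr
        _ = |κ - s * a ^ 2| := by rw [← hρ2, ← mul_sub, abs_mul, abs_of_pos hs]
        _ ≤ ε := hκ
    have hdec : (s * a) • (ρ • v - θ) = (κ • v - (s * a) • θ) - (s * (ρ * (ρ - a))) • v := by
      rw [← hρ2]; module
    have key : s * a * ‖ρ • v - θ‖ ≤ 2 * ε := by
      calc s * a * ‖ρ • v - θ‖ = ‖(s * a) • (ρ • v - θ)‖ := by
            rw [norm_smul, Real.norm_of_nonneg (by positivity)]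
        _ ≤ ‖κ • v - (s * a) • θ‖ + ‖(s * (ρ * (ρ - a))) • v‖ := by
            rw [hdec]; exact norm_sub_le _ _
        _ ≤ ε + ε := by
            gcongr
            rw [norm_smul, hv, mul_one, Real.norm_eq_abs, abs_mul, abs_mul, abs_of_pos hs,
              abs_of_nonneg hρ]
            exact hρa
        _ = 2 * ε := by ring
    calc ‖ρ • v - θ‖ * (s * t) ≤ ‖ρ • v - θ‖ * (s * (2 * a)) := by gcongr
      _ = 2 * (s * a * ‖ρ • v - θ‖) := by ring
      _ ≤ 10 * ε := by linarith

/-- The spectrum is finite, so its supremum bounds it; hence `lambdaMax A - A` has nonnegative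
spectrum and is positive semidefinite. -/
lemma inner_toEuclideanLin_le_lambdaMax {d : ℕ} {A : Matrix (Fin d) (Fin d) ℝ} (hA : A.IsSymm)
    (x : EuclideanSpace ℝ (Fin d)) :
    ⟪x, Matrix.toEuclideanLin A x⟫ ≤ lambdaMax A * ‖x‖ ^ 2 := by
  have hH : A.IsHermitian := by
    rw [Matrix.IsHermitian, Matrix.conjTranspose_eq_transpose_of_trivial]; exact hA
  have hbdd : BddAbove (spectrum ℝ A) := (Matrix.finite_real_spectrum (A := A)).bddAbove
  have hpos : (algebraMap ℝ (Matrix (Fin d) (Fin d) ℝ) (lambdaMax A) - A).PosSemidef := by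
    rw [Matrix.posSemidef_iff_isHermitian_and_spectrum_nonneg]
    refine ⟨?_, ?_⟩
    · refine Matrix.IsHermitian.sub ?_ hH
      rw [Matrix.algebraMap_eq_diagonal]
      exact Matrix.isHermitian_diagonal _
    · intro μ hμ
      rw [← spectrum.singleton_sub_eq] at hμ
      obtain ⟨_, rfl, ν, hν, rfl⟩ := hμ
      exact sub_nonneg.2 (le_csSup hbdd hν)
  have h := hpos.re_dotProduct_nonneg (WithLp.ofLp x)
  simp only [Matrix.sub_mulVec, dotProduct_sub, Algebra.algebraMap_eq_smul_one, Matrix.smul_mulVec,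
    Matrix.one_mulVec, dotProduct_smul] at h
  rw [EuclideanSpace.norm_sq_eq, EuclideanSpace.inner_eq_star_dotProduct]
  simp [dotProduct, mul_comm, sq] at h ⊢
  simpa [mul_comm] using h

/-- A finite set of at most `5 ^ d` unit vectors which norms every vector up to a factor two. -/
lemma exists_norming_finset {d : ℕ} (hd : 1 ≤ d) :
    ∃ N : Finset (EuclideanSpace ℝ (Fin d)), N.card ≤ 5 ^ d ∧ (∀ y ∈ N, ‖y‖ = 1) ∧
      ∀ w : EuclideanSpace ℝ (Fin d), ∃ y ∈ N, ‖w‖ ≤ 2 * ⟪w, y⟫ := by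
  classical
  let V := EuclideanSpace ℝ (Fin d)
  let P : Finset V → Prop := fun s =>
    (∀ c ∈ s, ‖c‖ = 1) ∧ ∀ c ∈ s, ∀ e ∈ s, c ≠ e → 1 / 2 ≤ ‖c - e‖
  have hcard : ∀ s, P s → s.card ≤ 5 ^ d := by
    intro s hs
    -- Doubling turns a `1/2`-separated set of unit vectors into a `1`-separated set in the ball of
    -- radius two, whose cardinality is at most `5 ^ d`.
    have h := Besicovitch.card_le_of_separated (s.image fun c : V => (2 : ℝ) • c) ?_ ?_
    · rwa [finrank_euclideanSpace_fin, Finset.card_image_of_injective _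
        (smul_right_injective V (two_ne_zero' ℝ))] at h
    · intro c hc
      obtain ⟨c, hc', rfl⟩ := Finset.mem_image.1 hc
      simp [norm_smul, hs.1 c hc']
    · intro c hc e he hne
      obtain ⟨c, hc', rfl⟩ := Finset.mem_image.1 hc
      obtain ⟨e, he', rfl⟩ := Finset.mem_image.1 he
      have := hs.2 c hc' e he' (by rintro rfl; exact hne rfl)
      rw [← smul_sub, norm_smul, Real.norm_eq_abs, abs_two]
      linarith
  -- A separated set of maximal cardinality is a `1/2`-net of the sphere.
  obtain ⟨N, hN, hNc⟩ := Nat.findGreatest_spec (P := fun m => ∃ s, P s ∧ s.card = m)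
    (n := 5 ^ d) (m := 0) (Nat.zero_le _) ⟨∅, by simp [P], rfl⟩
  have hnet : ∀ u : V, ‖u‖ = 1 → ∃ y ∈ N, ‖u - y‖ ≤ 1 / 2 := by
    intro u hu
    by_contra! hcon
    have huN : u ∉ N := fun h => by have := hcon u h; simp at this; linarith
    have hP : P (insert u N) := by
      refine ⟨?_, ?_⟩
      · intro c hc
        rcases Finset.mem_insert.1 hc with rfl | hc
        exacts [hu, hN.1 c hc]
      · intro c hc e he hne
        rcases Finset.mem_insert.1 hc with rfl | hc' <;>
          rcases Finset.mem_insert.1 he with rfl | he'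
        · exact absurd rfl hne
        · exact (hcon e he').le
        · rw [norm_sub_rev]; exact (hcon c hc').le
        · exact hN.2 c hc' e he' hne
    have h1 := Nat.le_findGreatest (P := fun m => ∃ s, P s ∧ s.card = m) (hcard _ hP) ⟨_, hP, rfl⟩
    rw [← hNc, Finset.card_insert_of_notMem huN] at h1
    omega
  refine ⟨N, hcard N hN, hN.1, fun w => ?_⟩
  have hunit : ∀ u : V, ‖u‖ = 1 → ∃ y ∈ N, 1 ≤ 2 * ⟪u, y⟫ := by
    intro u hu
    obtain ⟨y, hy, huy⟩ := hnet u hu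
    refine ⟨y, hy, ?_⟩
    have h := norm_sub_sq_real u y
    rw [hu, hN.1 y hy] at h
    nlinarith [norm_nonneg (u - y)]
  rcases eq_or_ne w 0 with rfl | hw
  -- Even `w = 0` needs a member of `N`; this is where `1 ≤ d` enters.
  · obtain ⟨y, hy, -⟩ := hunit (EuclideanSpace.single ⟨0, hd⟩ (1 : ℝ))
      ((PiLp.norm_single _ _ _ _).trans norm_one)
    exact ⟨y, hy, by simp⟩
  · have hw' : 0 < ‖w‖ := norm_pos_iff.2 hw
    obtain ⟨y, hy, h⟩ := hunit (‖w‖⁻¹ • w) (norm_smul_inv_norm hw)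
    refine ⟨y, hy, ?_⟩
    rw [real_inner_smul_left] at h
    calc ‖w‖ = ‖w‖ * 1 := by ring
      _ ≤ ‖w‖ * (2 * (‖w‖⁻¹ * ⟪w, y⟫)) := by gcongr
      _ = 2 * ⟪w, y⟫ := by field_simp

/-- The operator norm of a symmetric operator is controlled by its values on a norming set. -/
lemma norm_apply_le_of_norming {V : Type*} [NormedAddCommGroup V] [InnerProductSpace ℝ V]
    {N : Finset V} (hnorm : ∀ w : V, ∃ y ∈ N, ‖w‖ ≤ 2 * ⟪w, y⟫)
    {F : V → V} (hF : ∀ x y, ⟪F x, y⟫ = ⟪x, F y⟫) {M : ℝ}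
    (hM : ∀ x ∈ N, ∀ y ∈ N, ⟪F x, y⟫ ≤ M) (z : V) : ‖F z‖ ≤ 4 * M * ‖z‖ := by
  -- Norm `F z` by `y`, move `F` onto `y` by symmetry, then norm `F y` by `x`: two factors of two.
  obtain ⟨y, hy, h⟩ := hnorm (F z)
  obtain ⟨x, hx, h'⟩ := hnorm (F y)
  have h1 := hM y hy x hx
  have h2 := real_inner_le_norm z (F y)
  rw [hF] at h
  nlinarith [norm_nonneg z]

end HiddenMarkovMixture

/-! ### Sub-Gaussian and sub-exponential concentration -/

namespace HiddenMarkovMixture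

section Probability

variable {Ω : Type*} [MeasurableSpace Ω] {μ : Measure Ω}

/-- Functions of disjoint blocks of independent random variables are independent. -/
lemma iIndepFun_blocks {ι κ β γ : Type*} [MeasurableSpace β]
    [MeasurableSpace γ] {W : ι → Ω → β} (hW : iIndepFun W μ) (hm : ∀ i, Measurable (W i))
    (B : κ → Finset ι) (hB : ∀ a b, a ≠ b → Disjoint (B a) (B b)) {g : ∀ c, (B c → β) → γ}
    (hg : ∀ c, Measurable (g c)) :
    iIndepFun (fun c ω => g c (fun j => W j ω)) μ := by
  classical
  have : IsProbabilityMeasure μ := hW.isProbabilityMeasure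
  rw [iIndepFun_iff_measure_inter_preimage_eq_mul]
  intro S sets hsets
  induction S using Finset.induction_on with
  | empty => simp
  | insert a S ha ih =>
    rw [Finset.set_biInter_insert, Finset.prod_insert ha,
      ← ih fun i hi => hsets i (Finset.mem_insert_of_mem hi)]
    have hdisj : Disjoint (B a) (S.biUnion B) := by
      rw [Finset.disjoint_biUnion_right]
      exact fun b hb => hB a b (by rintro rfl; exact ha hb)
    have hsub : ∀ c ∈ S, ∀ j ∈ B c, j ∈ S.biUnion B := fun c hc j hj =>
      Finset.mem_biUnion.2 ⟨c, hc, hj⟩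
    have h := (hW.indepFun_finset (B a) (S.biUnion B) hdisj hm).measure_inter_preimage_eq_mul
      (g a ⁻¹' sets a)
      (⋂ c : S, (fun (x : S.biUnion B → β) =>
        g c (fun j : B c => x ⟨j, hsub c c.2 j j.2⟩)) ⁻¹' sets c)
      (hg a (hsets a (Finset.mem_insert_self a S)))
      (MeasurableSet.iInter fun c => by
        refine ((hg c).comp (measurable_pi_lambda _ fun j => measurable_pi_apply _))
          (hsets c (Finset.mem_insert_of_mem c.2)))
    convert! h using 2
    · congr 1
      ext ω
      simp
    · congr 1
      ext ω
      simp

lemma hasSubgaussianMGF_const_mul {X : Ω → ℝ} {c : NNReal} (h : HasSubgaussianMGF X c μ)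
    (r : ℝ) {c' : NNReal} (hc : r ^ 2 * c ≤ (c' : ℝ)) :
    HasSubgaussianMGF (fun ω => r * X ω) c' μ where
  integrable_exp_mul t := by simpa [mul_assoc] using h.integrable_exp_mul (t * r)
  mgf_le t := by
    have := h.mgf_le (t * r)
    calc mgf (fun ω => r * X ω) μ t = mgf X μ (t * r) := by simp [mgf, mul_assoc]
      _ ≤ _ := this
      _ = Real.exp (r ^ 2 * c * t ^ 2 / 2) := by ring_nf
      _ ≤ _ := by gcongr

/-- From `1 + t m ≤ E exp(tX) ≤ exp(ct²/2)`, with equality throughout at `t = 0`, the difference of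
the outer terms has a minimum there, so its derivative `-m` vanishes. The model does not assume
centred noise; centring comes from here. -/
lemma integral_le_zero_of_hasSubgaussianMGF [IsProbabilityMeasure μ] {X : Ω → ℝ} {c : NNReal}
    (h : HasSubgaussianMGF X c μ) : ∫ ω, X ω ∂μ ≤ 0 := by
  by_contra! hpos
  set m := ∫ ω, X ω ∂μ
  have key : ∀ t : ℝ, 1 + t * m ≤ Real.exp (c * t ^ 2 / 2) := fun t => by
    refine le_trans ?_ (h.mgf_le t)
    have h1 : ∫ ω, (1 + t * X ω) ∂μ = 1 + t * m := by
      rw [integral_add (integrable_const _) (h.integrable.const_mul t), integral_const_mul]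
      simp [m]
    rw [← h1]
    exact integral_mono ((integrable_const _).add (h.integrable.const_mul t))
      (h.integrable_exp_mul t) fun ω => by
        have := Real.add_one_le_exp (t * X ω); simp only; linarith
  have hd1 : HasDerivAt (fun t : ℝ => Real.exp (c * t ^ 2 / 2) - (1 + t * m)) (0 - m) 0 := by
    have h2 : HasDerivAt (fun t : ℝ => (c : ℝ) * t ^ 2 / 2) 0 0 := by
      simpa using ((hasDerivAt_pow 2 (0 : ℝ)).const_mul (c : ℝ)).div_const 2
    have h3 : HasDerivAt (fun t : ℝ => 1 + t * m) m 0 := by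
      simpa using ((hasDerivAt_id (0 : ℝ)).mul_const m).const_add 1
    exact (h2.exp.sub h3).congr_deriv (by simp)
  have hmin : IsLocalMin (fun t : ℝ => Real.exp (c * t ^ 2 / 2) - (1 + t * m)) 0 :=
    Filter.Eventually.of_forall fun t => by
      have := key t
      simp
      linarith
  have := hmin.hasDerivAt_eq_zero hd1
  linarith

lemma integral_eq_zero_of_hasSubgaussianMGF [IsProbabilityMeasure μ] {X : Ω → ℝ} {c : NNReal}
    (h : HasSubgaussianMGF X c μ) : ∫ ω, X ω ∂μ = 0 := by
  refine le_antisymm (integral_le_zero_of_hasSubgaussianMGF h) ?_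
  have := integral_le_zero_of_hasSubgaussianMGF h.neg
  simp only [Pi.neg_apply, integral_neg] at this
  linarith

lemma lintegral_exp_sq_gaussianReal :
    ∫⁻ g, ENNReal.ofReal (Real.exp (g ^ 2 / 4)) ∂(gaussianReal 0 1) = ENNReal.ofReal √2 := by
  rw [gaussianReal_of_var_ne_zero _ one_ne_zero, lintegral_withDensity_eq_lintegral_mul _
    (measurable_gaussianPDF 0 1) (by fun_prop)]
  have : ∀ g : ℝ, (gaussianPDF 0 1 * fun g => ENNReal.ofReal (Real.exp (g ^ 2 / 4))) g =
      ENNReal.ofReal ((√(2 * Real.pi))⁻¹ * Real.exp (-(1 / 4) * g ^ 2)) := fun g => by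
    rw [Pi.mul_apply, gaussianPDF, ← ENNReal.ofReal_mul (gaussianPDFReal_nonneg _ _ _),
      gaussianPDFReal, mul_assoc, ← Real.exp_add]
    congr 2
    · simp
    · congr 1
      simp
      ring
  simp_rw [this]
  rw [← ofReal_integral_eq_lintegral_ofReal
    ((integrable_exp_neg_mul_sq (by norm_num)).const_mul _)
    (Filter.Eventually.of_forall fun g => by positivity), integral_const_mul, integral_gaussian]
  congr 1
  rw [show Real.pi / (1 / 4) = 2 * (2 * Real.pi) by ring, Real.sqrt_mul zero_le_two (2 * Real.pi),
    mul_comm √2, inv_mul_cancel_left₀ (by positivity)]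

/-- Linearise the square by a standard Gaussian `g`: `exp(z²/4) = E exp(z g / √2)`. Exchanging the
integrals and applying the moment bound at `g / √2` leaves `E exp(g²/4) = √2`. -/
lemma lintegral_exp_sq_le [IsProbabilityMeasure μ] {Z : Ω → ℝ} (hZ : Measurable Z)
    (h : HasSubgaussianMGF Z 1 μ) :
    ∫⁻ ω, ENNReal.ofReal (Real.exp (Z ω ^ 2 / 4)) ∂μ ≤ ENNReal.ofReal √2 := by
  have hg : ∀ z : ℝ, ENNReal.ofReal (Real.exp (z ^ 2 / 4)) =
      ∫⁻ g, ENNReal.ofReal (Real.exp (z / √2 * g)) ∂(gaussianReal 0 1) := fun z => by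
    rw [← ofReal_integral_eq_lintegral_ofReal (integrable_exp_mul_gaussianReal _)
      (Filter.Eventually.of_forall fun g => by positivity)]
    have := mgf_gaussianReal (p := gaussianReal 0 1) (X := id) (μ := 0) (v := 1) (by simp) (z / √2)
    rw [mgf] at this
    simp only [id] at this
    rw [this, div_pow, Real.sq_sqrt (by norm_num)]
    congr 2
    simp
    ring
  simp_rw [hg]
  rw [lintegral_lintegral_swap (by fun_prop), ← lintegral_exp_sq_gaussianReal]
  refine lintegral_mono fun g => ?_
  have hint := h.integrable_exp_mul (g / √2)
  have hle := h.mgf_le (g / √2)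
  have heq : ∀ ω, Real.exp (Z ω / √2 * g) = Real.exp (g / √2 * Z ω) := fun ω => by
    congr 1; ring
  simp_rw [heq]
  rw [← ofReal_integral_eq_lintegral_ofReal hint
    (Filter.Eventually.of_forall fun g => by positivity)]
  refine ENNReal.ofReal_le_ofReal (hle.trans_eq ?_)
  rw [div_pow, Real.sq_sqrt (by norm_num)]
  congr 1
  simp
  ring

lemma integrable_exp_sq [IsProbabilityMeasure μ] {Z : Ω → ℝ} (hZ : Measurable Z)
    (h : HasSubgaussianMGF Z 1 μ) : Integrable (fun ω => Real.exp (Z ω ^ 2 / 4)) μ := by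
  refine ⟨by fun_prop, ?_⟩
  rw [hasFiniteIntegral_iff_ofReal (Filter.Eventually.of_forall fun g => by positivity)]
  exact (lintegral_exp_sq_le hZ h).trans_lt ENNReal.ofReal_lt_top

lemma integral_exp_sq_le [IsProbabilityMeasure μ] {Z : Ω → ℝ} (hZ : Measurable Z)
    (h : HasSubgaussianMGF Z 1 μ) : ∫ ω, Real.exp (Z ω ^ 2 / 4) ∂μ ≤ √2 := by
  rw [integral_eq_lintegral_of_nonneg_ae (Filter.Eventually.of_forall fun g => by positivity)
    (by fun_prop)]
  exact ENNReal.toReal_le_of_le_ofReal (by positivity) (lintegral_exp_sq_le hZ h)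

/-- The centred product of two sub-Gaussian variables has an exponential moment. -/
lemma exp_abs_mul_sub_moment [IsProbabilityMeasure μ] {Z W : Ω → ℝ} (hZ : Measurable Z)
    (hW : Measurable W) (hZs : HasSubgaussianMGF Z 1 μ) (hWs : HasSubgaussianMGF W 1 μ)
    {p : ℝ} (hp : |p| ≤ 1) :
    Integrable (fun ω => Real.exp (|Z ω * W ω - p| / 4)) μ ∧
      ∫ ω, Real.exp (|Z ω * W ω - p| / 4) ∂μ ≤ 2 := by
  have hi := ((integrable_exp_sq hZ hZs).add (integrable_exp_sq hW hWs)).const_mul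
    (Real.exp (1 / 4) / 2)
  have hle : ∀ ω, Real.exp (|Z ω * W ω - p| / 4) ≤
      Real.exp (1 / 4) / 2 * (Real.exp (Z ω ^ 2 / 4) + Real.exp (W ω ^ 2 / 4)) := fun ω => by
    set x := Real.exp (Z ω ^ 2 / 8) with hx
    set y := Real.exp (W ω ^ 2 / 8) with hy
    have h1 : Real.exp (Z ω ^ 2 / 4) = x ^ 2 := by
      rw [hx, ← Real.exp_nat_mul]; congr 1; push_cast; ring
    have h2 : Real.exp (W ω ^ 2 / 4) = y ^ 2 := by
      rw [hy, ← Real.exp_nat_mul]; congr 1; push_cast; ring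
    have h3 : |Z ω * W ω - p| / 4 ≤ 1 / 4 + (Z ω ^ 2 / 8 + W ω ^ 2 / 8) := by
      have h4 : |Z ω * W ω - p| ≤ |Z ω * W ω| + |p| := abs_sub _ _
      have h5 : |Z ω * W ω| ≤ (Z ω ^ 2 + W ω ^ 2) / 2 := by
        rw [abs_le]; constructor <;> nlinarith [sq_nonneg (Z ω + W ω), sq_nonneg (Z ω - W ω)]
      linarith
    rw [h1, h2]
    calc _ ≤ Real.exp (1 / 4 + (Z ω ^ 2 / 8 + W ω ^ 2 / 8)) := Real.exp_le_exp.2 h3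
      _ = Real.exp (1 / 4) * (x * y) := by rw [Real.exp_add, Real.exp_add]
      _ ≤ Real.exp (1 / 4) * ((x ^ 2 + y ^ 2) / 2) := by
        gcongr; nlinarith [sq_nonneg (x - y)]
      _ = _ := by ring
  have hint : Integrable (fun ω => Real.exp (|Z ω * W ω - p| / 4)) μ :=
    hi.mono' (by fun_prop) (Filter.Eventually.of_forall fun ω => by
      rw [Real.norm_of_nonneg (by positivity)]; exact hle ω)
  refine ⟨hint, (integral_mono hint hi hle).trans ?_⟩
  simp only [Pi.add_apply]
  rw [integral_const_mul, integral_add (integrable_exp_sq hZ hZs) (integrable_exp_sq hW hWs)]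
  have h1 := integral_exp_sq_le hZ hZs
  have h2 := integral_exp_sq_le hW hWs
  -- Equivalent to `e ≤ 4`; it turns `exp(1/4) / 2 * 2√2` into at most `2`.
  have h3 : Real.exp (1 / 4) ≤ √2 := by
    refine Real.le_sqrt_of_sq_le ?_
    rw [← Real.exp_nat_mul]
    have h4 : Real.exp (((2 : ℕ) : ℝ) * (1 / 4)) ^ 2 ≤ 2 ^ 2 := by
      rw [← Real.exp_nat_mul]
      have := Real.exp_one_lt_d9
      norm_num
      linarith
    exact le_of_sq_le_sq h4 (by norm_num)
  have h6 : √2 * √2 = 2 := Real.mul_self_sqrt (by norm_num)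
  calc _ ≤ √2 / 2 * (√2 + √2) := by gcongr
    _ = 2 := by linarith

lemma integrable_exp_mul_of_exp_abs {U : Ω → ℝ} (hU : Measurable U)
    (hi : Integrable (fun ω => Real.exp (|U ω| / 4)) μ) {t : ℝ} (ht : |t| ≤ 1 / 8) :
    Integrable (fun ω => Real.exp (t * U ω)) μ :=
  hi.mono' (by fun_prop) (Filter.Eventually.of_forall fun ω => by
    rw [Real.norm_of_nonneg (by positivity)]
    refine Real.exp_le_exp.2 ((le_abs_self _).trans ?_)
    rw [abs_mul]
    nlinarith [abs_nonneg (U ω)])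

/-- A centred variable with an exponential moment is sub-Gaussian near the origin. -/
lemma mgf_le_of_exp_abs [IsProbabilityMeasure μ] {U : Ω → ℝ} (hU : Measurable U)
    (hi : Integrable (fun ω => Real.exp (|U ω| / 4)) μ)
    (hle : ∫ ω, Real.exp (|U ω| / 4) ∂μ ≤ 2) (h0 : ∫ ω, U ω ∂μ = 0) {t : ℝ} (ht : |t| ≤ 1 / 8) :
    mgf U μ t ≤ Real.exp (256 * t ^ 2) := by
  have hUi : Integrable U μ := (hi.const_mul 4).mono' (by fun_prop)
    (Filter.Eventually.of_forall fun ω => by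
      have := Real.add_one_le_exp (|U ω| / 4)
      rw [Real.norm_eq_abs]; linarith)
  -- Second-order Taylor remainder `x² exp|x|` at `x = tU`. Half of `exp(|U|/4)` absorbs `exp|x|`,
  -- the other half absorbs `U²` at the cost of `128`; integration doubles this to `256`.
  have hpt : ∀ ω, Real.exp (t * U ω) ≤ 1 + t * U ω + 128 * t ^ 2 * Real.exp (|U ω| / 4) := by
    intro ω
    have h1 : Real.exp (t * U ω) ≤ 1 + t * U ω + (t * U ω) ^ 2 * Real.exp |t * U ω| := by
      have h := Complex.norm_exp_sub_sum_le_norm_mul_exp ((t * U ω : ℝ) : ℂ) 2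
      rw [← Complex.ofReal_exp] at h
      simp only [Finset.sum_range_succ, Finset.sum_range_zero] at h
      norm_num at h
      have h' : ‖((Real.exp (t * U ω) - (1 + t * U ω) : ℝ) : ℂ)‖ ≤
          (|t| * |U ω|) ^ 2 * Real.exp (|t| * |U ω|) := by
        push_cast; simpa using h
      rw [Complex.norm_real, Real.norm_eq_abs, ← abs_mul, sq_abs] at h'
      linarith [le_abs_self (Real.exp (t * U ω) - (1 + t * U ω))]
    have h2 : |t * U ω| ≤ |U ω| / 8 := by
      rw [abs_mul]; nlinarith [abs_nonneg (U ω)]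
    have h3 : U ω ^ 2 ≤ 128 * Real.exp (|U ω| / 8) := by
      have := Real.quadratic_le_exp_of_nonneg (x := |U ω| / 8) (by positivity)
      have h4 := sq_abs (U ω)
      nlinarith [abs_nonneg (U ω)]
    have h4 : Real.exp (|U ω| / 4) = Real.exp (|U ω| / 8) * Real.exp (|U ω| / 8) := by
      rw [← Real.exp_add]; congr 1; ring
    have h5 : (t * U ω) ^ 2 * Real.exp |t * U ω| ≤ 128 * t ^ 2 * Real.exp (|U ω| / 4) := by
      rw [h4, mul_pow]
      calc t ^ 2 * U ω ^ 2 * Real.exp |t * U ω|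
          ≤ t ^ 2 * (128 * Real.exp (|U ω| / 8)) * Real.exp (|U ω| / 8) := by gcongr
        _ = _ := by ring
    linarith
  have hr : Integrable (fun ω => 1 + t * U ω + 128 * t ^ 2 * Real.exp (|U ω| / 4)) μ :=
    ((integrable_const _).add (hUi.const_mul t)).add (hi.const_mul _)
  have h1 := integral_mono (integrable_exp_mul_of_exp_abs hU hi ht) hr hpt
  have h2 : Integrable (fun ω => 1 + t * U ω) μ := (integrable_const _).add (hUi.const_mul t)
  rw [integral_add h2 (hi.const_mul _), integral_add (integrable_const _) (hUi.const_mul t), integral_const_mul, integral_const_mul,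
    h0] at h1
  simp only [integral_const, probReal_univ, smul_eq_mul, mul_one, mul_zero, add_zero] at h1
  calc mgf U μ t ≤ _ := h1
    _ ≤ 256 * t ^ 2 + 1 := by nlinarith [sq_nonneg t]
    _ ≤ _ := Real.add_one_le_exp _

/-- A Bernstein inequality for sums of `l` independent variables at deviation level `d`. -/
lemma measure_sum_ge_le_exp [IsProbabilityMeasure μ] {d l : ℕ} {U : Fin l → Ω → ℝ}
    (hU : ∀ i, Measurable (U i)) (hind : iIndepFun U μ)
    (hi : ∀ i, Integrable (fun ω => Real.exp (|U i ω| / 4)) μ)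
    (hle : ∀ i, ∫ ω, Real.exp (|U i ω| / 4) ∂μ ≤ 2) (h0 : ∀ i, ∫ ω, U i ω ∂μ = 0) :
    μ.real {ω | 80 * (√((d : ℝ) * l) + d) ≤ ∑ i, U i ω} ≤ Real.exp (-6 * d) := by
  -- The Chernoff parameter is `min(1, √(d/l)) / 8`. The exponent becomes at most `-80 · d/8 + 256 ·
  -- d/64 = -6d`.
  obtain ⟨t, ht0, ht8, h1, h2⟩ : ∃ t : ℝ, 0 ≤ t ∧ t ≤ 1 / 8 ∧ l * t ^ 2 ≤ d / 64 ∧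
      (d : ℝ) / 8 ≤ t * (√((d : ℝ) * l) + d) := by
    rcases le_total l d with h | h
    · refine ⟨1 / 8, by norm_num, le_rfl, ?_, ?_⟩
      · have : (l : ℝ) ≤ d := by exact_mod_cast h
        linarith
      · have := Real.sqrt_nonneg ((d : ℝ) * l)
        linarith
    · rcases Nat.eq_zero_or_pos l with rfl | hl
      · obtain rfl : d = 0 := by omega
        exact ⟨0, by norm_num, by norm_num, by norm_num, by norm_num⟩
      have hl' : (0 : ℝ) < l := by exact_mod_cast hl
      have hdl : (d : ℝ) ≤ l := by exact_mod_cast h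
      refine ⟨√((d : ℝ) / l) / 8, by positivity, ?_, ?_, ?_⟩
      · have : √((d : ℝ) / l) ≤ 1 := Real.sqrt_le_one.2 (div_le_one_of_le₀ hdl hl'.le)
        linarith
      · rw [div_pow, Real.sq_sqrt (by positivity)]
        apply le_of_eq; field_simp; norm_num
      · have h3 : √((d : ℝ) / l) * √((d : ℝ) * l) = d := by
          rw [← Real.sqrt_mul (by positivity), show (d : ℝ) / l * (d * l) = d ^ 2 by field_simp,
            Real.sqrt_sq (by positivity)]
        have : 0 ≤ √((d : ℝ) / l) / 8 * d := by positivity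
        nlinarith
  have habs : |t| ≤ 1 / 8 := by rwa [abs_of_nonneg ht0]
  have hint := hind.integrable_exp_mul_sum (t := t) (s := Finset.univ) hU
    fun i _ => integrable_exp_mul_of_exp_abs (hU i) (hi i) habs
  have h := measure_ge_le_exp_mul_mgf (80 * (√((d : ℝ) * l) + d)) ht0 hint
  simp only [Finset.sum_apply] at h
  refine h.trans ?_
  rw [hind.mgf_sum hU]
  calc _ ≤ Real.exp (-t * (80 * (√((d : ℝ) * l) + d))) *
        ∏ i : Fin l, Real.exp (256 * t ^ 2) := by
        gcongr with i
        · exact fun i _ => mgf_nonneg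
        · exact mgf_le_of_exp_abs (hU i) (hi i) (hle i) (h0 i) habs
    _ = Real.exp (-t * (80 * (√((d : ℝ) * l) + d)) + l * (256 * t ^ 2)) := by
        rw [Finset.prod_const, Finset.card_univ, Fintype.card_fin, ← Real.exp_nat_mul,
          Real.exp_add]
    _ ≤ _ := Real.exp_le_exp.2 (by nlinarith)

end Probability

end HiddenMarkovMixture

/-! ### Buckets and the noise fluctuations -/

namespace HiddenMarkovMixture

section Noise

lemma card_bucket {n k l : ℕ} (hn : n = k * l) (i : Fin l) : (bucket n k i).card = k := by
  have hi : ((i : ℕ) + 1) * k ≤ n := by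
    rw [hn, mul_comm k l]; exact Nat.mul_le_mul_right k i.2
  have : (bucket n k i).map Fin.valEmbedding = Finset.Ico ((i : ℕ) * k) (((i : ℕ) + 1) * k) := by
    ext j
    simp only [bucket, Finset.mem_map, Finset.mem_filter, Finset.mem_univ, true_and,
      Fin.valEmbedding_apply, Finset.mem_Ico]
    constructor
    · rintro ⟨a, ha, rfl⟩; exact ha
    · intro h; exact ⟨⟨j, h.2.trans_le hi⟩, h, rfl⟩
  rw [← Finset.card_map Fin.valEmbedding, this, Nat.card_Ico, Nat.add_mul, one_mul]
  omega

lemma disjoint_bucket {n k l : ℕ} (i j : Fin l) (hij : i ≠ j) :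
    Disjoint (bucket n k i) (bucket n k j) := by
  rw [Finset.disjoint_left]
  intro m hi hj
  simp only [bucket, Finset.mem_filter, Finset.mem_univ, true_and] at hi hj
  have h1 : (i : ℕ) < j + 1 := lt_of_mul_lt_mul_right (hi.1.trans_lt hj.2) (Nat.zero_le k)
  have h2 : (j : ℕ) < i + 1 := lt_of_mul_lt_mul_right (hj.1.trans_lt hi.2) (Nat.zero_le k)
  exact hij (Fin.ext (by omega))

variable {Ω : Type*} [MeasurableSpace Ω] {μ : Measure Ω} {d n : ℕ}
  {ξ : Fin n → Ω → EuclideanSpace ℝ (Fin d)}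

lemma IsNoise.hasSubgaussianMGF_inner (h : IsNoise μ ξ) {x : EuclideanSpace ℝ (Fin d)}
    (hx : ‖x‖ = 1) (j : Fin n) : HasSubgaussianMGF (fun ω => ⟪x, ξ j ω⟫) 1 μ where
  integrable_exp_mul t := by
    simpa [real_inner_smul_left] using (h.subGaussian j (t • x)).1
  mgf_le t := by
    simpa [real_inner_smul_left, norm_smul, hx, mgf] using (h.subGaussian j (t • x)).2

lemma memLp_two_of_hasSubgaussianMGF {X : Ω → ℝ} {c : NNReal} (h : HasSubgaussianMGF X c μ) :
    MemLp X 2 μ := by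
  simpa using h.memLp 2

lemma IsNoise.memLp_coord (h : IsNoise μ ξ) (j : Fin n) (a : Fin d) :
    MemLp (fun ω => ξ j ω a) 2 μ := by
  have h1 := (h.hasSubgaussianMGF_inner (x := EuclideanSpace.single a (1 : ℝ)) (by simp) j).memLp 2
  simpa [EuclideanSpace.inner_single_left] using h1

lemma IsNoise.integral_inner_mul_inner (h : IsNoise μ ξ) (x y : EuclideanSpace ℝ (Fin d))
    (j : Fin n) : ∫ ω, ⟪x, ξ j ω⟫ * ⟪y, ξ j ω⟫ ∂μ = ⟪x, y⟫ := by
  have hint : ∀ a b, Integrable (fun ω => ξ j ω a * ξ j ω b) μ := fun a b =>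
    (h.memLp_coord j a).integrable_mul (h.memLp_coord j b)
  have heq : ∀ ω, ⟪x, ξ j ω⟫ * ⟪y, ξ j ω⟫ =
      ∑ a, ∑ b, x a * y b * (ξ j ω a * ξ j ω b) := fun ω => by
    simp only [PiLp.inner_apply, RCLike.inner_apply, conj_trivial, Finset.sum_mul_sum]
    refine Finset.sum_congr rfl fun a _ => Finset.sum_congr rfl fun b _ => by ring
  simp_rw [heq]
  rw [integral_finsetSum _ fun a _ => integrable_finsetSum _ fun b _ => (hint a b).const_mul _]
  have : ∀ a, ∫ ω, ∑ b, x a * y b * (ξ j ω a * ξ j ω b) ∂μ = x a * y a := fun a => by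
    rw [integral_finsetSum _ fun b _ => (hint a b).const_mul _]
    simp_rw [integral_const_mul, h.isotropic j a]
    simp
  simp_rw [this]
  simp [PiLp.inner_apply, mul_comm]

/-- The normalised sum `k ^ (-1 / 2) ∑ j, x j` over the `i`-th bucket. -/
noncomputable def bucketSum {E : Type*} [AddCommGroup E] [Module ℝ E] {n : ℕ} (k : ℕ) {l : ℕ}
    (x : Fin n → E) (i : Fin l) : E :=
  (√(k : ℝ))⁻¹ • ∑ j ∈ bucket n k i, x j

lemma bucketMean_eq_bucketSum {E : Type*} [AddCommGroup E] [Module ℝ E] {n k l : ℕ}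
    (x : Fin n → E) (i : Fin l) : bucketMean k x i = (√(k : ℝ))⁻¹ • bucketSum k x i := by
  rw [bucketMean, bucketSum, smul_smul, ← mul_inv, Real.mul_self_sqrt (Nat.cast_nonneg k), one_div]

lemma inner_bucketSum (k : ℕ) {l : ℕ} (x : EuclideanSpace ℝ (Fin d))
    (z : Fin n → EuclideanSpace ℝ (Fin d)) (i : Fin l) :
    ⟪x, bucketSum k z i⟫ = (√(k : ℝ))⁻¹ * ∑ j ∈ bucket n k i, ⟪x, z j⟫ := by
  rw [bucketSum, real_inner_smul_right, inner_sum]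

variable {k l : ℕ}

lemma IsNoise.iIndepFun_bucketSum (h : IsNoise μ ξ) :
    iIndepFun (fun (i : Fin l) ω => bucketSum k (fun j => ξ j ω) i) μ := by
  have := iIndepFun_blocks h.indep h.measurable (bucket n k) (disjoint_bucket (l := l))
    (g := fun i z => (√(k : ℝ))⁻¹ • ∑ j : bucket n k i, z j) (by intro c; fun_prop)
  refine (iIndepFun_congr fun i => Filter.Eventually.of_forall fun ω => ?_).1 this
  simp only [bucketSum]
  rw [← Finset.sum_coe_sort (bucket n k i)]

lemma IsNoise.measurable_bucketSum (h : IsNoise μ ξ) (i : Fin l) :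
    Measurable fun ω => bucketSum k (fun j => ξ j ω) i := by
  have := h.measurable
  unfold bucketSum
  fun_prop

/-- Variance proxies of independent terms add up to `k`, and the factor `k^(-1/2)` brings this back
to one. -/
lemma IsNoise.hasSubgaussianMGF_bucketSum (h : IsNoise μ ξ) (hn : n = k * l) (hk : 1 ≤ k)
    {x : EuclideanSpace ℝ (Fin d)} (hx : ‖x‖ = 1) (i : Fin l) :
    HasSubgaussianMGF (fun ω => ⟪x, bucketSum k (fun j => ξ j ω) i⟫) 1 μ := by
  simp_rw [inner_bucketSum]
  have hind : iIndepFun (fun j ω => ⟪x, ξ j ω⟫) μ :=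
    h.indep.comp (fun _ z => ⟪x, z⟫) fun _ => by fun_prop
  refine hasSubgaussianMGF_const_mul (HasSubgaussianMGF.sum_of_iIndepFun hind
    (c := fun _ => 1) fun j _ => h.hasSubgaussianMGF_inner hx j) _ ?_
  have : (0 : ℝ) < k := by exact_mod_cast hk
  rw [Finset.sum_const, card_bucket hn, inv_pow, Real.sq_sqrt this.le]
  simp [this.ne']

/-- Isotropy survives normalised summation: cross terms vanish by independence and centring, and the
`k` diagonal terms cancel `1/k`. -/
lemma IsNoise.integral_bucketSum [IsProbabilityMeasure μ] (h : IsNoise μ ξ) (hn : n = k * l) (hk : 1 ≤ k)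
    {x y : EuclideanSpace ℝ (Fin d)} (hx : ‖x‖ = 1) (hy : ‖y‖ = 1) (i : Fin l) :
    ∫ ω, ⟪x, bucketSum k (fun j => ξ j ω) i⟫ * ⟪y, bucketSum k (fun j => ξ j ω) i⟫ ∂μ =
      ⟪x, y⟫ := by
  have hk' : (0 : ℝ) < k := by exact_mod_cast hk
  have hsx := fun j => h.hasSubgaussianMGF_inner hx j
  have hsy := fun j => h.hasSubgaussianMGF_inner hy j
  have hint : ∀ a b, Integrable (fun ω => ⟪x, ξ a ω⟫ * ⟪y, ξ b ω⟫) μ := fun a b =>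
    (memLp_two_of_hasSubgaussianMGF (hsx a)).integrable_mul
      (memLp_two_of_hasSubgaussianMGF (hsy b))
  have hoff : ∀ a b, a ≠ b → ∫ ω, ⟪x, ξ a ω⟫ * ⟪y, ξ b ω⟫ ∂μ = 0 := fun a b hab => by
    have hi : IndepFun (fun ω => ⟪x, ξ a ω⟫) (fun ω => ⟪y, ξ b ω⟫) μ :=
      (h.indep.indepFun hab).comp (φ := fun z => ⟪x, z⟫) (ψ := fun z => ⟪y, z⟫)
        (by fun_prop) (by fun_prop)
    rw [hi.integral_fun_mul_eq_mul_integral (hsx a).aestronglyMeasurable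
      (hsy b).aestronglyMeasurable, integral_eq_zero_of_hasSubgaussianMGF (hsx a), zero_mul]
  have heq : ∀ ω, ⟪x, bucketSum k (fun j => ξ j ω) i⟫ * ⟪y, bucketSum k (fun j => ξ j ω) i⟫ =
      (k : ℝ)⁻¹ * ∑ a ∈ bucket n k i, ∑ b ∈ bucket n k i, ⟪x, ξ a ω⟫ * ⟪y, ξ b ω⟫ := fun ω => by
    rw [inner_bucketSum, inner_bucketSum, mul_mul_mul_comm, ← mul_inv,
      Real.mul_self_sqrt hk'.le, Finset.sum_mul_sum]
  simp_rw [heq]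
  rw [integral_const_mul, integral_finsetSum _ fun a _ => integrable_finsetSum _ fun b _ =>
    hint a b]
  have : ∀ a ∈ bucket n k i, ∫ ω, ∑ b ∈ bucket n k i, ⟪x, ξ a ω⟫ * ⟪y, ξ b ω⟫ ∂μ = ⟪x, y⟫ := by
    intro a ha
    rw [integral_finsetSum _ fun b _ => hint a b, Finset.sum_eq_single_of_mem a ha
      fun b _ hb => hoff a b hb.symm, h.integral_inner_mul_inner]
  rw [Finset.sum_congr rfl this, Finset.sum_const, card_bucket hn, nsmul_eq_mul,
    inv_mul_cancel_left₀ hk'.ne']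

lemma measureReal_exists_le {ι : Type*} (N : Finset ι) (A : ι → Set Ω) {p : ℝ} (hp : 0 ≤ p)
    (hA : ∀ x ∈ N, μ.real (A x) ≤ p) {q : ℝ} (hN : (N.card : ℝ) ≤ q) :
    μ.real {ω | ∃ x ∈ N, ω ∈ A x} ≤ q * p := by
  have : {ω | ∃ x ∈ N, ω ∈ A x} = ⋃ x ∈ N, A x := by ext; simp
  rw [this]
  calc _ ≤ ∑ x ∈ N, μ.real (A x) := measureReal_biUnion_finset_le N A
    _ ≤ N.card • p := Finset.sum_le_card_nsmul N _ p hA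
    _ ≤ q * p := by rw [nsmul_eq_mul]; gcongr

/-- Since `5 = 1 + 2 + 2²/2 ≤ e²`, each union bound over the norming set costs `2` in the rate.
Covariance needs a pair of directions, so its rate drops from `6` to `2`. -/
lemma five_pow_mul_exp_le (d : ℕ) (c : ℝ) :
    (5 : ℝ) ^ d * Real.exp (-(c + 2) * d) ≤ Real.exp (-c * d) := by
  have h5 : (5 : ℝ) ≤ Real.exp 2 := by
    have := Real.quadratic_le_exp_of_nonneg (x := 2) (by norm_num)
    norm_num at this ⊢
    exact this
  calc _ ≤ Real.exp 2 ^ d * Real.exp (-(c + 2) * d) := by gcongr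
    _ = Real.exp (-c * d) := by rw [← Real.exp_nat_mul, ← Real.exp_add]; congr 1; ring

/-- Deviation of the empirical covariance of the normalised bucket sums, over a finite set of
directions. -/
lemma IsNoise.measure_exists_covariance_le [IsProbabilityMeasure μ] (h : IsNoise μ ξ) (hn : n = k * l) (hk : 1 ≤ k)
    {N : Finset (EuclideanSpace ℝ (Fin d))} (hN : ∀ x ∈ N, ‖x‖ = 1) (hcard : N.card ≤ 5 ^ d) :
    μ.real {ω | ∃ x ∈ N, ∃ y ∈ N, 80 * (√((d : ℝ) * l) + d) ≤
      ∑ i : Fin l, (⟪x, bucketSum k (fun j => ξ j ω) i⟫ * ⟪y, bucketSum k (fun j => ξ j ω) i⟫ -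
        ⟪x, y⟫)} ≤ Real.exp (-2 * d) := by
  have hcard' : (N.card : ℝ) ≤ 5 ^ d := by exact_mod_cast hcard
  have hone : ∀ x ∈ N, ∀ y ∈ N, μ.real {ω | 80 * (√((d : ℝ) * l) + d) ≤
      ∑ i : Fin l, (⟪x, bucketSum k (fun j => ξ j ω) i⟫ * ⟪y, bucketSum k (fun j => ξ j ω) i⟫ -
        ⟪x, y⟫)} ≤ Real.exp (-6 * d) := by
    intro x hx y hy
    have hmx : ∀ i : Fin l, Measurable fun ω => ⟪x, bucketSum k (fun j => ξ j ω) i⟫ := fun i =>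
      (h.measurable_bucketSum i).const_inner
    have hmy : ∀ i : Fin l, Measurable fun ω => ⟪y, bucketSum k (fun j => ξ j ω) i⟫ := fun i =>
      (h.measurable_bucketSum i).const_inner
    have hsx := fun i : Fin l => h.hasSubgaussianMGF_bucketSum hn hk (hN x hx) i
    have hsy := fun i : Fin l => h.hasSubgaussianMGF_bucketSum hn hk (hN y hy) i
    have hp : |⟪x, y⟫| ≤ 1 := by
      simpa [hN x hx, hN y hy] using abs_real_inner_le_norm x y
    have hexp := fun i : Fin l => exp_abs_mul_sub_moment (hmx i) (hmy i) (hsx i) (hsy i) hp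
    refine measure_sum_ge_le_exp (fun i => ((hmx i).mul (hmy i)).sub_const _) ?_
      (fun i => (hexp i).1) (fun i => (hexp i).2) fun i => ?_
    · exact (h.iIndepFun_bucketSum (k := k) (l := l)).comp (fun _ z => ⟪x, z⟫ * ⟪y, z⟫ - ⟪x, y⟫)
        fun _ => by fun_prop
    · have hxy : Integrable (fun ω => ⟪x, bucketSum k (fun j => ξ j ω) i⟫ *
          ⟪y, bucketSum k (fun j => ξ j ω) i⟫) μ :=
        (memLp_two_of_hasSubgaussianMGF (hsx i)).integrable_mul
          (memLp_two_of_hasSubgaussianMGF (hsy i))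
      rw [integral_sub hxy (integrable_const _), h.integral_bucketSum hn hk (hN x hx) (hN y hy)]
      simp
  have hin : ∀ x ∈ N, μ.real {ω | ∃ y ∈ N, 80 * (√((d : ℝ) * l) + d) ≤
      ∑ i : Fin l, (⟪x, bucketSum k (fun j => ξ j ω) i⟫ * ⟪y, bucketSum k (fun j => ξ j ω) i⟫ -
        ⟪x, y⟫)} ≤ Real.exp (-4 * d) := fun x hx => by
    refine (measureReal_exists_le N _ (Real.exp_pos _).le (hone x hx) hcard').trans ?_
    have := five_pow_mul_exp_le d 4
    norm_num at this ⊢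
    exact this
  refine (measureReal_exists_le N _ (Real.exp_pos _).le hin hcard').trans ?_
  have := five_pow_mul_exp_le d 2
  norm_num at this ⊢
  exact this

/-- A sum of independent sub-Gaussian variables with bounded random weights, independent of them,
is sub-Gaussian. -/
lemma hasSubgaussianMGF_sum_mul [IsProbabilityMeasure μ] {A X : Fin l → Ω → ℝ} (hA : ∀ i, Measurable (A i))
    (hA1 : ∀ i ω, |A i ω| ≤ 1) (hX : ∀ i, Measurable (X i)) (hind : iIndepFun X μ)
    (hsub : ∀ i, HasSubgaussianMGF (X i) 1 μ)
    (hAX : IndepFun (fun ω i => A i ω) (fun ω i => X i ω) μ) :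
    HasSubgaussianMGF (fun ω => ∑ i, A i ω * X i ω) l μ := by
  have hfix : ∀ a : Fin l → ℝ, (∀ i, |a i| ≤ 1) →
      HasSubgaussianMGF (fun ω => ∑ i, a i * X i ω) l μ := fun a ha => by
    have := HasSubgaussianMGF.sum_of_iIndepFun (s := Finset.univ)
      (hind.comp (fun i z => a i * z) fun i => by fun_prop)
      (c := fun _ => 1) fun i _ => hasSubgaussianMGF_const_mul (hsub i) (a i) (c' := 1) (by
        have := sq_le_one_iff_abs_le_one (a i) |>.2 (ha i)
        simpa using this)
    simpa using this
  have hAm : Measurable (fun ω i => A i ω) := measurable_pi_lambda _ hA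
  have hXm : Measurable (fun ω i => X i ω) := measurable_pi_lambda _ hX
  -- Independence factors the joint law, so the weights can be frozen before integrating over `X`.
  -- The bound is for `∫⁻` because integrability of the exponential is deduced from it.
  have key : ∀ t : ℝ, ∫⁻ ω, ENNReal.ofReal (Real.exp (t * ∑ i, A i ω * X i ω)) ∂μ ≤
      ENNReal.ofReal (Real.exp (((l : NNReal) : ℝ) * t ^ 2 / 2)) := fun t => by
    let F : (Fin l → ℝ) × (Fin l → ℝ) → ENNReal := fun p =>
      ENNReal.ofReal (Real.exp (t * ∑ i, p.1 i * p.2 i))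
    have hF : Measurable F := by fun_prop
    have h1 : ∫⁻ ω, F (fun i => A i ω, fun i => X i ω) ∂μ =
        ∫⁻ ω', ∫⁻ ω, F (fun i => A i ω', fun i => X i ω) ∂μ ∂μ := by
      rw [← lintegral_map (f := F) hF (hAm.prodMk hXm),
        (indepFun_iff_map_prod_eq_prod_map_map hAm.aemeasurable hXm.aemeasurable).1 hAX,
        lintegral_prod _ hF.aemeasurable, lintegral_map hF.lintegral_prod_right' hAm]
      refine lintegral_congr fun ω' => ?_
      exact lintegral_map (hF.comp measurable_prodMk_left) hXm
    change ∫⁻ ω, F (fun i => A i ω, fun i => X i ω) ∂μ ≤ _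
    rw [h1]
    calc _ ≤ ∫⁻ _, ENNReal.ofReal (Real.exp (((l : NNReal) : ℝ) * t ^ 2 / 2)) ∂μ := by
          refine lintegral_mono fun ω' => ?_
          have h2 := hfix (fun i => A i ω') fun i => hA1 i ω'
          have h3 := h2.integrable_exp_mul t
          simp only [F]
          rw [← ofReal_integral_eq_lintegral_ofReal h3
            (Filter.Eventually.of_forall fun _ => by positivity)]
          exact ENNReal.ofReal_le_ofReal (h2.mgf_le t)
      _ = _ := by simp
  have hmeas : ∀ t : ℝ, Measurable fun ω => Real.exp (t * ∑ i, A i ω * X i ω) := fun t => by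
    fun_prop
  refine ⟨fun t => ⟨(hmeas t).aestronglyMeasurable, ?_⟩, fun t => ?_⟩
  · rw [hasFiniteIntegral_iff_ofReal (Filter.Eventually.of_forall fun _ => by positivity)]
    exact (key t).trans_lt ENNReal.ofReal_lt_top
  · rw [mgf, integral_eq_lintegral_of_nonneg_ae
      (Filter.Eventually.of_forall fun _ => by positivity) (hmeas t).aestronglyMeasurable]
    exact ENNReal.toReal_le_of_le_ofReal (by positivity) (key t)

lemma IsNoise.measure_exists_weighted_sum_le [IsProbabilityMeasure μ] (h : IsNoise μ ξ) (hn : n = k * l) (hk : 1 ≤ k)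
    (hl : 1 ≤ l) {A : Fin l → Ω → ℝ} (hA : ∀ i, Measurable (A i)) (hA1 : ∀ i ω, |A i ω| ≤ 1)
    (hAξ : IndepFun (fun ω i => A i ω) (fun ω i => ξ i ω) μ)
    {N : Finset (EuclideanSpace ℝ (Fin d))} (hN : ∀ x ∈ N, ‖x‖ = 1) (hcard : N.card ≤ 5 ^ d) :
    μ.real {ω | ∃ y ∈ N, 4 * √((d : ℝ) * l) ≤
      -- Proxy `l` and level `4√(dl)` give `exp(-8d)` per direction, with room left after the union
      -- bound.
      ⟪∑ i : Fin l, A i ω • bucketSum k (fun j => ξ j ω) i, y⟫} ≤ Real.exp (-2 * d) := by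
  have hcard' : (N.card : ℝ) ≤ 5 ^ d := by exact_mod_cast hcard
  refine (measureReal_exists_le N _ (p := Real.exp (-(6 + 2) * d)) (Real.exp_pos _).le
    (fun y hy => ?_) hcard').trans ((five_pow_mul_exp_le d 6).trans
      (Real.exp_le_exp.2 (by nlinarith [(Nat.cast_nonneg d : (0 : ℝ) ≤ d)])))
  have hS : ∀ i : Fin l, Measurable fun ω => ⟪y, bucketSum k (fun j => ξ j ω) i⟫ := fun i =>
      (h.measurable_bucketSum i).const_inner
  have hsum := hasSubgaussianMGF_sum_mul hA hA1 hS
    ((h.iIndepFun_bucketSum (k := k) (l := l)).comp (fun _ z => ⟪y, z⟫) fun _ => by fun_prop)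
    (h.hasSubgaussianMGF_bucketSum hn hk (hN y hy))
    (hAξ.comp (φ := id) (ψ := fun z i => ⟪y, bucketSum k z i⟫) measurable_id (by
      unfold bucketSum; fun_prop))
  have hb := hsum.measure_ge_le (ε := 4 * √((d : ℝ) * l)) (by positivity)
  have hl' : (0 : ℝ) < l := by exact_mod_cast hl
  rw [mul_pow, Real.sq_sqrt (by positivity), NNReal.coe_natCast,
    show -((4 : ℝ) ^ 2 * (d * l)) / (2 * l) = -(6 + 2) * d by field_simp; ring] at hb
  have heq : ∀ ω, ⟪∑ i : Fin l, A i ω • bucketSum k (fun j => ξ j ω) i, y⟫ =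
      ∑ i, A i ω * ⟪y, bucketSum k (fun j => ξ j ω) i⟫ := fun ω => by
    rw [sum_inner]
    exact Finset.sum_congr rfl fun i _ => by rw [real_inner_smul_left, real_inner_comm y]
  simp_rw [← heq] at hb
  exact hb

end Noise

end HiddenMarkovMixture

/-! ### The sign chain: independent flips and the bucket energies -/

namespace HiddenMarkovMixture

section Chain

/-- The first value of a sequence followed by the products of its consecutive values. -/
def signFlip {n : ℕ} (x : Fin n → ℝ) (j : Fin n) : ℝ :=
  if (j : ℕ) = 0 then x j else x j * x ⟨(j : ℕ) - 1, by omega⟩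

lemma measurable_signFlip {n : ℕ} (j : Fin n) : Measurable fun x : Fin n → ℝ => signFlip x j := by
  unfold signFlip
  split_ifs <;> fun_prop

lemma signFlip_succ {Ω : Type*} {n : ℕ} {η : Fin n → Ω → ℝ} {i j : Fin n}
    (hij : (j : ℕ) = (i : ℕ) + 1) (ω : Ω) :
    signFlip (fun m => η m ω) j = η j ω * η i ω := by
  simp [signFlip, hij]

variable {Ω : Type*} [MeasurableSpace Ω] {μ : Measure Ω} {n : ℕ} {δ : ℝ} {η : Fin n → Ω → ℝ}

lemma IsSymmetricSignChain.measurable_signFlip (h : IsSymmetricSignChain μ δ η) (j : Fin n) :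
    Measurable fun ω => signFlip (fun m => η m ω) j :=
  (HiddenMarkovMixture.measurable_signFlip j).comp (measurable_pi_lambda _ h.measurable)

/-- The transition rule, for all events determined by the past. -/
lemma IsSymmetricSignChain.measure_inter_signFlip [IsFiniteMeasure μ]
    (h : IsSymmetricSignChain μ δ η) (hδ : 0 < δ)
    {i j : Fin n} (hij : (j : ℕ) = (i : ℕ) + 1) (A : Set (Fin n → ℝ))
    (hA : ∀ x y : Fin n → ℝ, (∀ m ≤ i, x m = y m) → x ∈ A → y ∈ A) :
    μ.real ({ω | (fun m => η m ω) ∈ A} ∩ {ω | η j ω = -η i ω}) =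
      δ * μ.real {ω | (fun m => η m ω) ∈ A} := by
  classical
  -- `X` encodes the past up to `i`, with default `true` afterwards. Each fibre is then either empty
  -- or exactly one of the events in the transition rule, and measures on this finite type may be
  -- compared on singletons.
  let X : Ω → Fin n → Bool := fun ω m => if m ≤ i then decide (η m ω = 1) else true
  let s : (Fin n → Bool) → Fin n → ℝ := fun b m => if b m then 1 else -1
  have hX : Measurable X := by
    refine measurable_pi_lambda _ fun m => ?_
    by_cases hm : m ≤ i
    · simp only [X, hm, if_true]
      have h1 : (fun ω => decide (η m ω = 1)) = fun ω => if η m ω = 1 then true else false := by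
        funext ω
        split_ifs with h1 <;> simp [h1]
      rw [h1]
      exact Measurable.ite ((h.measurable m) (measurableSet_singleton 1)) measurable_const
        measurable_const
    · simp only [X, hm, if_false]
      exact measurable_const
  have hXs : ∀ ω, ∀ m ≤ i, s (X ω) m = η m ω := fun ω m hm => by
    simp only [s, X, hm, if_true, decide_eq_true_eq]
    rcases h.sign m ω with h1 | h1 <;> rw [h1] <;> norm_num
  have hXA : ∀ ω, (fun m => η m ω) ∈ A ↔ X ω ∈ {b | s b ∈ A} := fun ω =>
    ⟨hA _ _ fun m hm => (hXs ω m hm).symm, hA _ _ fun m hm => hXs ω m hm⟩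
  have hfib : ∀ b, X ⁻¹' {b} = {ω | ∀ m ≤ i, η m ω = s b m} ∨ X ⁻¹' {b} = ∅ := by
    intro b
    by_cases hb : ∀ m, ¬ m ≤ i → b m = true
    · left
      ext ω
      simp only [Set.mem_preimage, Set.mem_singleton_iff, Set.mem_ofPred_eq]
      constructor
      · rintro rfl m hm; exact (hXs ω m hm).symm
      · intro hω
        funext m
        by_cases hm : m ≤ i
        · have := hω m hm
          simp only [X, hm, if_true, this, s]
          cases b m <;> norm_num
        · simp [X, hm, hb m hm]
    · right
      push Not at hb
      obtain ⟨m, hm, hbm⟩ := hb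
      ext ω
      simp only [Set.mem_preimage, Set.mem_singleton_iff, Set.mem_empty_iff_false, iff_false]
      rintro rfl
      simp [X, hm] at hbm
  have hmeas : (μ.restrict {ω | η j ω = -η i ω}).map X = (ENNReal.ofReal δ • μ).map X := by
    refine Measure.ext_of_singleton fun b => ?_
    rw [Measure.map_apply hX (measurableSet_singleton b),
      Measure.map_apply hX (measurableSet_singleton b),
      Measure.restrict_apply (hX (measurableSet_singleton b))]
    rcases hfib b with hb | hb
    · have ht := h.transition i j hij (s b)
      rw [hb, Measure.smul_apply, smul_eq_mul]
      have h1 : {ω | ∀ m ≤ i, η m ω = s b m} ∩ {ω | η j ω = -η i ω} =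
          {ω | (∀ m ≤ i, η m ω = s b m) ∧ η j ω = -η i ω} := rfl
      rw [h1, ← ofReal_measureReal, ht, ENNReal.ofReal_mul hδ.le, ofReal_measureReal]
    · rw [hb]; simp
  have hT := congrArg (fun ν : Measure (Fin n → Bool) => ν {b | s b ∈ A}) hmeas
  have hTm : MeasurableSet {b | s b ∈ A} := Set.toFinite _ |>.measurableSet
  simp only [Measure.map_apply hX hTm, Measure.restrict_apply (hX hTm), Measure.smul_apply,
    smul_eq_mul] at hT
  have hpre : {ω | (fun m => η m ω) ∈ A} = X ⁻¹' {b | s b ∈ A} := by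
    ext ω; exact hXA ω
  rw [hpre, Measure.real, hT, ENNReal.toReal_mul, ENNReal.toReal_ofReal hδ.le, Measure.real]

lemma measureReal_inter_compl_eq_mul [IsProbabilityMeasure μ] {B D : Set Ω}
    (hD : MeasurableSet D) (h : μ.real (B ∩ D) = μ.real B * μ.real D) :
    μ.real (B ∩ Dᶜ) = μ.real B * μ.real Dᶜ := by
  have h1 := measureReal_inter_add_sdiff (μ := μ) (s := B) hD
  rw [Set.sdiff_eq] at h1
  rw [probReal_compl_eq_one_sub hD]
  linarith

lemma IsSymmetricSignChain.signFlip_eq (h : IsSymmetricSignChain μ δ η) {i j : Fin n}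
    (hij : (j : ℕ) = (i : ℕ) + 1) (ω : Ω) :
    (η j ω = -η i ω ∧ signFlip (fun m => η m ω) j = -1) ∨
      (η j ω ≠ -η i ω ∧ signFlip (fun m => η m ω) j = 1) := by
  rw [signFlip_succ hij]
  rcases h.sign i ω with hi | hi <;> rcases h.sign j ω with hj | hj <;> rw [hi, hj] <;> norm_num

/-- A flip is independent of all events determined by the past. -/
lemma IsSymmetricSignChain.measure_inter_signFlip_mem [IsProbabilityMeasure μ]
    (h : IsSymmetricSignChain μ δ η) (hδ : 0 < δ)
    {i j : Fin n} (hij : (j : ℕ) = (i : ℕ) + 1) (A : Set (Fin n → ℝ))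
    (hA : ∀ x y : Fin n → ℝ, (∀ m ≤ i, x m = y m) → x ∈ A → y ∈ A) (T : Set ℝ) :
    μ.real ({ω | (fun m => η m ω) ∈ A} ∩ {ω | signFlip (fun m => η m ω) j ∈ T}) =
      μ.real {ω | (fun m => η m ω) ∈ A} * μ.real {ω | signFlip (fun m => η m ω) j ∈ T} := by
  set B := {ω | (fun m => η m ω) ∈ A}
  set D := {ω | η j ω = -η i ω} with hD_def
  have hD : MeasurableSet D := measurableSet_eq_fun (h.measurable j) (h.measurable i).neg
  have hDu : μ.real D = δ := by
    have := h.measure_inter_signFlip hδ hij Set.univ (by simp)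
    simpa using this
  have hBD : μ.real (B ∩ D) = μ.real B * μ.real D := by
    rw [hDu, h.measure_inter_signFlip hδ hij A hA, mul_comm]
  have hflip := h.signFlip_eq hij
  -- A flip takes only the values `±1`, so only the membership of these two points in `T` matters.
  by_cases h1 : (1 : ℝ) ∈ T <;> by_cases h2 : (-1 : ℝ) ∈ T
  · have : {ω | signFlip (fun m => η m ω) j ∈ T} = Set.univ := by
      ext ω; rcases hflip ω with ⟨_, hw⟩ | ⟨_, hw⟩ <;> simp [hw, h1, h2]
    rw [this]; simp
  · have : {ω | signFlip (fun m => η m ω) j ∈ T} = Dᶜ := by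
      ext ω; rcases hflip ω with ⟨hd, hw⟩ | ⟨hd, hw⟩ <;> simp [hw, h1, h2, hd, D]
    rw [this]; exact measureReal_inter_compl_eq_mul hD hBD
  · have : {ω | signFlip (fun m => η m ω) j ∈ T} = D := by
      ext ω; rcases hflip ω with ⟨hd, hw⟩ | ⟨hd, hw⟩ <;> simp [hw, h1, h2, hd, D]
    rw [this]; exact hBD
  · have : {ω | signFlip (fun m => η m ω) j ∈ T} = ∅ := by
      ext ω; rcases hflip ω with ⟨hd, hw⟩ | ⟨hd, hw⟩ <;> simp [hw, h1, h2]
    rw [this]; simp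

lemma IsSymmetricSignChain.measure_forall_signFlip_mem [IsProbabilityMeasure μ]
    (h : IsSymmetricSignChain μ δ η) (hδ : 0 < δ) (T : Fin n → Set ℝ) (r : ℕ) (hr : r ≤ n) :
    μ.real {ω | ∀ m : Fin n, (m : ℕ) < r → signFlip (fun m => η m ω) m ∈ T m} =
      ∏ m ∈ Finset.univ.filter (fun m : Fin n => (m : ℕ) < r),
        μ.real {ω | signFlip (fun m => η m ω) m ∈ T m} := by
  induction r with
  | zero => simp
  | succ r ih =>
    have hins : (Finset.univ.filter fun m : Fin n => (m : ℕ) < r + 1) =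
        insert ⟨r, hr⟩ (Finset.univ.filter fun m : Fin n => (m : ℕ) < r) := by
      ext m; simp [Fin.ext_iff]; omega
    rw [hins, Finset.prod_insert (by simp), ← ih (by omega)]
    have hset : {ω | ∀ m : Fin n, (m : ℕ) < r + 1 → signFlip (fun m => η m ω) m ∈ T m} =
        {ω | (fun m => η m ω) ∈ {x | ∀ m : Fin n, (m : ℕ) < r → signFlip x m ∈ T m}} ∩
          {ω | signFlip (fun m => η m ω) ⟨r, hr⟩ ∈ T ⟨r, hr⟩} := by
      ext ω
      simp only [Set.mem_ofPred_eq, Set.mem_inter_iff]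
      constructor
      · exact fun hω => ⟨fun m hm => hω m (by omega), hω ⟨r, hr⟩ (by simp)⟩
      · rintro ⟨h1, h2⟩ m hm
        rcases Nat.lt_succ_iff_lt_or_eq.1 hm with hm | hm
        · exact h1 m hm
        · obtain rfl : m = ⟨r, hr⟩ := Fin.ext hm
          exact h2
    rw [hset, mul_comm]
    -- Index `0` carries the initial sign itself; nothing precedes it, so no transition is used.
    rcases Nat.eq_zero_or_pos r with rfl | hr0
    · simp
    · refine h.measure_inter_signFlip_mem hδ (i := ⟨r - 1, by omega⟩) (by simp; omega) _ ?_ _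
      intro x y hxy hx m hm
      have h1 := hxy m (by rw [Fin.le_def]; simp; omega)
      have h2 := hxy ⟨(m : ℕ) - 1, by omega⟩ (by rw [Fin.le_def]; simp; omega)
      have : signFlip y m = signFlip x m := by simp only [signFlip, h1, h2]
      rw [this]; exact hx m hm

lemma IsSymmetricSignChain.iIndepFun_signFlip [IsProbabilityMeasure μ]
    (h : IsSymmetricSignChain μ δ η) (hδ : 0 < δ) :
    iIndepFun (fun j ω => signFlip (fun m => η m ω) j) μ := by
  classical
  rw [iIndepFun_iff_measure_inter_preimage_eq_mul]
  intro S T hT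
  -- Coordinates outside `S` are filled with `Set.univ`, whose factors are one.
  have key := h.measure_forall_signFlip_mem hδ (fun m => if m ∈ S then T m else Set.univ) n le_rfl
  have h1 : {ω | ∀ m : Fin n, (m : ℕ) < n →
      signFlip (fun m => η m ω) m ∈ (if m ∈ S then T m else Set.univ)} =
      ⋂ i ∈ S, (fun ω => signFlip (fun m => η m ω) i) ⁻¹' T i := by
    ext ω
    simp only [Set.mem_ofPred_eq, Set.mem_iInter, Set.mem_preimage]
    constructor
    · intro hω i hi
      have := hω i i.2
      rwa [if_pos hi] at this
    · intro hω m _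
      split_ifs with hm
      exacts [hω m hm, Set.mem_univ _]
  have h2 : ∏ m ∈ Finset.univ.filter (fun m : Fin n => (m : ℕ) < n),
      μ.real {ω | signFlip (fun m => η m ω) m ∈ (if m ∈ S then T m else Set.univ)} =
      ∏ i ∈ S, μ.real ((fun ω => signFlip (fun m => η m ω) i) ⁻¹' T i) := by
    have h3 : ∀ m : Fin n,
        μ.real {ω | signFlip (fun m => η m ω) m ∈ (if m ∈ S then T m else Set.univ)} =
        if m ∈ S then μ.real ((fun ω => signFlip (fun m => η m ω) m) ⁻¹' T m) else 1 := fun m => by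
      split_ifs
      · rfl
      · simp
    simp only [h3, Fin.is_lt, Finset.filter_true]
    simp
  rw [h1, h2] at key
  rw [← ofReal_measureReal (μ := μ), key, ENNReal.ofReal_prod_of_nonneg fun _ _ => by positivity]
  exact Finset.prod_congr rfl fun i _ => ofReal_measureReal

/-- Each step avoids a flip with probability `1 - δ > 0`, independently. This constant path makes
the expected energy positive. -/
lemma IsSymmetricSignChain.measure_forall_signFlip_eq_one_pos [IsProbabilityMeasure μ]
    (h : IsSymmetricSignChain μ δ η) (hδ : 0 < δ) (hδ1 : δ < 1) :
    0 < μ.real {ω | ∀ m : Fin n, (m : ℕ) ≠ 0 → signFlip (fun m => η m ω) m = 1} := by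
  have key := h.measure_forall_signFlip_mem hδ
    (fun m => if (m : ℕ) = 0 then Set.univ else {1}) n le_rfl
  have h1 : {ω | ∀ m : Fin n, (m : ℕ) < n →
      signFlip (fun m => η m ω) m ∈ (if (m : ℕ) = 0 then Set.univ else {1} : Set ℝ)} =
      {ω | ∀ m : Fin n, (m : ℕ) ≠ 0 → signFlip (fun m => η m ω) m = 1} := by
    ext ω
    simp only [Set.mem_ofPred_eq]
    refine forall_congr' fun m => ?_
    by_cases hm : (m : ℕ) = 0 <;> simp [hm]
  rw [← h1, key]
  refine Finset.prod_pos fun m _ => ?_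
  by_cases hm : (m : ℕ) = 0
  · simp [hm]
  · have hij : (m : ℕ) = ((⟨m - 1, by omega⟩ : Fin n) : ℕ) + 1 := by simp; omega
    set i : Fin n := ⟨m - 1, by omega⟩
    have hD : MeasurableSet {ω | η m ω = -η i ω} :=
      measurableSet_eq_fun (h.measurable m) (h.measurable i).neg
    have hDu : μ.real {ω | η m ω = -η i ω} = δ := by
      have := h.measure_inter_signFlip hδ hij Set.univ (by simp)
      simpa using this
    have : {ω | signFlip (fun m => η m ω) m ∈ (if (m : ℕ) = 0 then Set.univ else {1} : Set ℝ)} =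
        {ω | η m ω = -η i ω}ᶜ := by
      ext ω
      rcases h.signFlip_eq hij ω with ⟨hd, hw⟩ | ⟨hd, hw⟩
      · simp [hm, hw, hd]; norm_num
      · simp [hm, hw, hd]
    rw [this, probReal_compl_eq_one_sub hD, hDu]
    linarith

variable {k l : ℕ}

/-- The square of the mean of a bucket of signs, as a function of the flips in this bucket. -/
noncomputable def energyOfFlips (n k : ℕ) {l : ℕ} (i : Fin l) (w : bucket n k i → ℝ) : ℝ :=
  -- The interval omits its left end, whose flip refers to the previous bucket. All remaining
  -- indices lie in the bucket, so the default `0` is never reached.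
  ((1 / (k : ℝ)) * ∑ m : bucket n k i, ∏ j ∈ Finset.Ioc ((i : ℕ) * k) (m : Fin n),
    if hj : ∃ h : j < n, ⟨j, h⟩ ∈ bucket n k i then w ⟨⟨j, hj.1⟩, hj.2⟩ else 0) ^ 2

lemma measurable_energyOfFlips (i : Fin l) : Measurable (energyOfFlips n k i) := by
  unfold energyOfFlips
  refine ((Finset.measurable_sum _ fun m _ => Finset.measurable_prod _ fun j _ => ?_).const_mul
    _).pow_const 2
  split_ifs <;> fun_prop

lemma IsSymmetricSignChain.sq_eq_one (h : IsSymmetricSignChain μ δ η) (j : Fin n) (ω : Ω) :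
    η j ω ^ 2 = 1 := by
  rcases h.sign j ω with h1 | h1 <;> rw [h1] <;> norm_num

/-- Each sign is the first sign of its bucket times the flips since then; the first sign factors out
of the mean and squares to one. -/
lemma IsSymmetricSignChain.energyOfFlips_eq (h : IsSymmetricSignChain μ δ η) (hn : n = k * l)
    (hk : 1 ≤ k) (i : Fin l) (ω : Ω) :
    energyOfFlips n k i (fun j => signFlip (fun m => η m ω) j) =
      bucketMean k (fun j => η j ω) i ^ 2 := by
  have hi : ((i : ℕ) + 1) * k ≤ n := by
    rw [hn, mul_comm k l]; exact Nat.mul_le_mul_right k i.2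
  have hi' : ((i : ℕ) + 1) * k = (i : ℕ) * k + k := by ring
  have hf : (i : ℕ) * k < n := by omega
  have key : ∀ m : ℕ, (i : ℕ) * k ≤ m → ∀ hm : m < ((i : ℕ) + 1) * k,
      η ⟨m, hm.trans_le hi⟩ ω = η ⟨(i : ℕ) * k, hf⟩ ω * ∏ j ∈ Finset.Ioc ((i : ℕ) * k) m,
        if hj : ∃ h : j < n, ⟨j, h⟩ ∈ bucket n k i then signFlip (fun m => η m ω) ⟨j, hj.1⟩ else 0 := by
    intro m hm0
    induction m, hm0 using Nat.le_induction with
    | base => intro _; simp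
    | succ m hm ih =>
      intro hm1
      have hmem : ∃ h : m + 1 < n, (⟨m + 1, h⟩ : Fin n) ∈ bucket n k i :=
        ⟨hm1.trans_le hi, by simp only [bucket, Finset.mem_filter, Finset.mem_univ, true_and]; omega⟩
      rw [← Finset.insert_Ioc_right_eq_Ioc_add_one hm, Finset.prod_insert (by simp), dif_pos hmem,
        mul_left_comm, ← ih (by omega), signFlip_succ (η := η) (i := ⟨m, by omega⟩) rfl, mul_assoc, ← sq,
        h.sq_eq_one, mul_one]
  have hsum : ∑ m ∈ bucket n k i, η m ω = η ⟨(i : ℕ) * k, hf⟩ ω *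
      ∑ m : bucket n k i, ∏ j ∈ Finset.Ioc ((i : ℕ) * k) (m : Fin n),
        if hj : ∃ h : j < n, ⟨j, h⟩ ∈ bucket n k i then
          signFlip (fun m => η m ω) ⟨j, hj.1⟩ else 0 := by
    rw [Finset.mul_sum, ← Finset.sum_coe_sort (bucket n k i)]
    refine Finset.sum_congr rfl fun m _ => ?_
    have hm := m.2
    simp only [bucket, Finset.mem_filter, Finset.mem_univ, true_and] at hm
    exact key m hm.1 hm.2
  rw [bucketMean, hsum, energyOfFlips, smul_eq_mul, mul_left_comm, mul_pow (η _ ω), h.sq_eq_one,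
    one_mul]

/-- Squaring forgets the sign that links a bucket to its past, leaving functions of disjoint blocks
of independent flips. -/
lemma IsSymmetricSignChain.iIndepFun_bucketMean_sq [IsProbabilityMeasure μ]
    (h : IsSymmetricSignChain μ δ η) (hδ : 0 < δ) (hn : n = k * l) (hk : 1 ≤ k) :
    iIndepFun (fun (i : Fin l) ω => bucketMean k (fun j => η j ω) i ^ 2) μ := by
  refine (iIndepFun_congr fun i => Filter.Eventually.of_forall fun ω => ?_).1
    (iIndepFun_blocks (h.iIndepFun_signFlip hδ) h.measurable_signFlip (bucket n k)
      (disjoint_bucket (l := l)) (measurable_energyOfFlips (n := n) (k := k)))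
  exact h.energyOfFlips_eq hn hk i ω

lemma IsSymmetricSignChain.measurable_bucketMean (h : IsSymmetricSignChain μ δ η) (i : Fin l) :
    Measurable fun ω => bucketMean k (fun j => η j ω) i := by
  have := h.measurable
  unfold bucketMean
  fun_prop

lemma IsSymmetricSignChain.abs_bucketMean_le (h : IsSymmetricSignChain μ δ η) (hn : n = k * l)
    (hk : 1 ≤ k) (i : Fin l) (ω : Ω) : |bucketMean k (fun j => η j ω) i| ≤ 1 := by
  have hk' : (0 : ℝ) < k := by exact_mod_cast hk
  have h1 : |∑ j ∈ bucket n k i, η j ω| ≤ k := by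
    refine (Finset.abs_sum_le_sum_abs _ _).trans ?_
    have : ∀ j ∈ bucket n k i, |η j ω| = 1 := fun j _ => by
      rcases h.sign j ω with h1 | h1 <;> simp [h1]
    rw [Finset.sum_congr rfl this, Finset.sum_const, card_bucket hn]
    simp
  rw [bucketMean, smul_eq_mul, abs_mul, abs_of_pos (by positivity), one_div,
    inv_mul_le_iff₀ hk', mul_one]
  exact h1

lemma IsSymmetricSignChain.integrable_bucketMean_sq [IsProbabilityMeasure μ]
    (h : IsSymmetricSignChain μ δ η) (hn : n = k * l) (hk : 1 ≤ k) (i : Fin l) :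
    Integrable (fun ω => bucketMean k (fun j => η j ω) i ^ 2) μ :=
  Integrable.of_mem_Icc 0 1 ((h.measurable_bucketMean i).pow_const 2).aemeasurable
    (Filter.Eventually.of_forall fun ω =>
      ⟨sq_nonneg _, (sq_le_one_iff_abs_le_one _).2 (h.abs_bucketMean_le hn hk i ω)⟩)

/-- Hoeffding for independent variables in `[0, 1]`, with proxy `1/4` each: every tail at `√(dl)` is
at most `exp(-dl / (l/2))`. -/
lemma IsSymmetricSignChain.measure_energy_deviation_le [IsProbabilityMeasure μ]
    (h : IsSymmetricSignChain μ δ η) (hδ : 0 < δ) (hn : n = k * l) (hk : 1 ≤ k) (hl : 1 ≤ l)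
    (d : ℕ) :
    μ.real {ω | √((d : ℝ) * l) ≤
      |∑ i : Fin l, bucketMean k (fun j => η j ω) i ^ 2 - expectedEnergy μ k l η|} ≤
      2 * Real.exp (-2 * d) := by
  have hl' : (0 : ℝ) < l := by exact_mod_cast hl
  have hE : expectedEnergy μ k l η = ∑ i : Fin l, ∫ ω, bucketMean k (fun j => η j ω) i ^ 2 ∂μ := by
    rw [expectedEnergy, integral_finsetSum _ fun i _ => h.integrable_bucketMean_sq hn hk i]
  have hsub : ∀ i : Fin l, HasSubgaussianMGF (fun ω => bucketMean k (fun j => η j ω) i ^ 2 -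
      ∫ ω, bucketMean k (fun j => η j ω) i ^ 2 ∂μ) (1 / 4) μ := fun i => by
    have := hasSubgaussianMGF_of_mem_Icc (μ := μ) (a := 0) (b := 1)
      (X := fun ω => bucketMean k (fun j => η j ω) i ^ 2)
      ((h.measurable_bucketMean i).pow_const 2).aemeasurable
      (Filter.Eventually.of_forall fun ω =>
        ⟨sq_nonneg _, (sq_le_one_iff_abs_le_one _).2 (h.abs_bucketMean_le hn hk i ω)⟩)
    convert this using 1
    ext
    norm_num
  have hind := (h.iIndepFun_bucketMean_sq hδ hn hk).comp
    (fun (i : Fin l) z => z - ∫ ω, bucketMean k (fun j => η j ω) i ^ 2 ∂μ) fun _ => by fun_prop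
  have hsum := HasSubgaussianMGF.sum_of_iIndepFun (s := Finset.univ) hind (c := fun _ => 1 / 4)
    fun i _ => hsub i
  have heq : ∀ ω, ∑ i : Fin l, bucketMean k (fun j => η j ω) i ^ 2 - expectedEnergy μ k l η =
      ∑ i : Fin l, (bucketMean k (fun j => η j ω) i ^ 2 -
        ∫ ω, bucketMean k (fun j => η j ω) i ^ 2 ∂μ) := fun ω => by
    rw [hE, Finset.sum_sub_distrib]
  have hexp : -√((d : ℝ) * l) ^ 2 / (2 * ((∑ _i : Fin l, (1 / 4 : NNReal) : NNReal) : ℝ)) =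
      -2 * d := by
    rw [Real.sq_sqrt (by positivity)]
    simp
    field_simp
    norm_num
  have h1 := hsum.measure_ge_le (ε := √((d : ℝ) * l)) (by positivity)
  have h2 := hsum.neg.measure_ge_le (ε := √((d : ℝ) * l)) (by positivity)
  rw [hexp] at h1 h2
  calc _ ≤ _ := measureReal_mono (fun ω hω => ?_) (by finiteness)
    _ ≤ _ := (measureReal_union_le _ _).trans (add_le_add h1 h2)
    _ = _ := by ring
  simp only [Set.mem_ofPred_eq, heq] at hω
  exact le_abs.1 hω

/-- On the path without flips every squared bucket mean is one, and this path has positive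
probability. -/
lemma IsSymmetricSignChain.expectedEnergy_pos [IsProbabilityMeasure μ]
    (h : IsSymmetricSignChain μ δ η) (hδ : 0 < δ) (hδ1 : δ < 1) (hn : n = k * l) (hk : 1 ≤ k)
    (hl : 1 ≤ l) : 0 < expectedEnergy μ k l η := by
  have hk' : (0 : ℝ) < k := by exact_mod_cast hk
  have hl' : (0 : ℝ) < l := by exact_mod_cast hl
  have hn0 : 0 < n := by rw [hn]; positivity
  rw [expectedEnergy, integral_pos_iff_support_of_nonneg
    (fun ω => Finset.sum_nonneg fun i _ => sq_nonneg _)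
    (integrable_finsetSum _ fun i _ => h.integrable_bucketMean_sq hn hk i)]
  have hpos := h.measure_forall_signFlip_eq_one_pos hδ hδ1
  rw [Measure.real, ENNReal.toReal_pos_iff] at hpos
  refine hpos.1.trans_le (measure_mono fun ω hω => ?_)
  have hconst : ∀ m : ℕ, ∀ hm : m < n, η ⟨m, hm⟩ ω = η ⟨0, hn0⟩ ω := by
    intro m
    induction m with
    | zero => intro _; rfl
    | succ m ih =>
      intro hm
      have h1 := hω ⟨m + 1, hm⟩ (by simp)
      rw [signFlip_succ (η := η) (i := ⟨m, by omega⟩) rfl] at h1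
      rw [← ih (by omega)]
      have h2 := h.sq_eq_one ⟨m, by omega⟩ ω
      rcases h.sign ⟨m, by omega⟩ ω with h3 | h3 <;> rw [h3] at h1 ⊢ <;> linarith
  have hmean : ∀ i : Fin l, bucketMean k (fun j => η j ω) i ^ 2 = 1 := fun i => by
    have : ∀ j ∈ bucket n k i, η j ω = η ⟨0, hn0⟩ ω := fun j _ => hconst j j.2
    rw [bucketMean, Finset.sum_congr rfl this, Finset.sum_const, card_bucket hn, nsmul_eq_mul,
      smul_eq_mul, one_div, inv_mul_cancel_left₀ hk'.ne', h.sq_eq_one]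
  simp only [Function.mem_support, hmean]
  simp
  omega

lemma IsSymmetricSignChain.sum_bucketMean_one_sq (h : IsSymmetricSignChain μ δ η) (hn : n = l)
    (ω : Ω) : ∑ i : Fin l, bucketMean 1 (fun j => η j ω) i ^ 2 = l := by
  have : ∀ i : Fin l, bucketMean 1 (fun j => η j ω) i ^ 2 = 1 := fun i => by
    obtain ⟨a, ha⟩ := Finset.card_eq_one.1 (card_bucket (n := n) (k := 1) (l := l) (by omega) i)
    simp [bucketMean, ha, h.sq_eq_one]
  simp [this]

lemma IsSymmetricSignChain.expectedEnergy_one [IsProbabilityMeasure μ]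
    (h : IsSymmetricSignChain μ δ η) (hn : n = l) : expectedEnergy μ 1 l η = l := by
  simp [expectedEnergy, h.sum_bucketMean_one_sq hn]

end Chain

end HiddenMarkovMixture

/-! ### The spectral estimator -/

namespace HiddenMarkovMixture

section Estimator

variable {d n k l : ℕ}

lemma isSymm_sampleCov (y : Fin n → EuclideanSpace ℝ (Fin d)) : (sampleCov k l y).IsSymm := by
  simp [Matrix.IsSymm, sampleCov, Matrix.transpose_smul, Matrix.transpose_mul]

lemma toEuclideanLin_sampleCov (y : Fin n → EuclideanSpace ℝ (Fin d))
    (x : EuclideanSpace ℝ (Fin d)) :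
    Matrix.toEuclideanLin (sampleCov k l y) x =
      (1 / (l : ℝ)) • ∑ i : Fin l, ⟪bucketMean k y i, x⟫ • bucketMean k y i := by
  ext a
  have h1 : ∀ i : Fin l, ⟪bucketMean k y i, x⟫ = ∑ b, x b * bucketMean k y i b := fun i => by
    simp [PiLp.inner_apply]
  simp only [Matrix.toLpLin_apply, sampleCov, Matrix.smul_mulVec, bucketMatrix, PiLp.smul_apply,
    Pi.smul_apply, h1, WithLp.ofLp_sum, Finset.sum_apply, WithLp.ofLp_smul,
    ← Matrix.mulVec_mulVec, Matrix.mulVec, dotProduct, Matrix.of_apply, Matrix.transpose_apply,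
    smul_eq_mul]
  congr 1
  refine Finset.sum_congr rfl fun i _ => ?_
  rw [mul_comm]
  congr 1
  exact Finset.sum_congr rfl fun b _ => mul_comm _ _

/-- The second moments of signal plus noise, compared with those of the signal. -/
lemma norm_secondMoment_sub_le {V : Type*} [NormedAddCommGroup V] [InnerProductSpace ℝ V]
    {θ : V} {b : Fin l → ℝ} {S : Fin l → V} {m r D G K : ℝ} (hl : 1 ≤ l) (hr : 0 ≤ r)
    (hD : |∑ i, b i ^ 2 - m| ≤ D) (hG : ‖∑ i, b i • S i‖ ≤ G)
    (hK : ∀ x, ‖∑ i, ⟪S i, x⟫ • S i - (l : ℝ) • x‖ ≤ K * ‖x‖) (x : V) :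
    ‖(1 / (l : ℝ)) • ∑ i, ⟪b i • θ + r • S i, x⟫ • (b i • θ + r • S i) - r ^ 2 • x -
      (m / l * ⟪θ, x⟫) • θ‖ ≤ 1 / l * (D * ‖θ‖ ^ 2 + 2 * r * ‖θ‖ * G + r ^ 2 * K) * ‖x‖ := by
  have hl' : (0 : ℝ) < l := by exact_mod_cast hl
  set g := ∑ i, b i • S i with hg
  have hexp : ∑ i, ⟪b i • θ + r • S i, x⟫ • (b i • θ + r • S i) =
      ((∑ i, b i ^ 2) * ⟪θ, x⟫) • θ + (r * ⟪θ, x⟫) • g + (r * ⟪g, x⟫) • θ +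
        r ^ 2 • ∑ i, ⟪S i, x⟫ • S i := by
    rw [hg, sum_inner, Finset.smul_sum, Finset.smul_sum, Finset.mul_sum, Finset.sum_mul,
      Finset.sum_smul, Finset.sum_smul, ← Finset.sum_add_distrib, ← Finset.sum_add_distrib,
      ← Finset.sum_add_distrib]
    refine Finset.sum_congr rfl fun i _ => ?_
    simp only [inner_add_left, real_inner_smul_left]
    module
  have hdec : (1 / (l : ℝ)) • ∑ i, ⟪b i • θ + r • S i, x⟫ • (b i • θ + r • S i) - r ^ 2 • x -
      (m / l * ⟪θ, x⟫) • θ = (1 / (l : ℝ)) • (((∑ i, b i ^ 2 - m) * ⟪θ, x⟫) • θ +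
        (r * ⟪θ, x⟫) • g + (r * ⟪g, x⟫) • θ + r ^ 2 • (∑ i, ⟪S i, x⟫ • S i - (l : ℝ) • x)) := by
    rw [hexp]
    have h1 : r ^ 2 • x = (1 / (l : ℝ)) • (r ^ 2 • ((l : ℝ) • x)) := by
      rw [smul_smul, smul_smul]; congr 1; field_simp
    have h2 : (m / l * ⟪θ, x⟫) • θ = (1 / (l : ℝ)) • ((m * ⟪θ, x⟫) • θ) := by
      rw [smul_smul]; congr 1; ring
    rw [h1, h2]
    module
  rw [hdec, norm_smul, Real.norm_of_nonneg (by positivity), mul_assoc]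
  refine mul_le_mul_of_nonneg_left ?_ (by positivity)
  have hθx := abs_real_inner_le_norm θ x
  have hgx : |⟪g, x⟫| ≤ G * ‖x‖ := (abs_real_inner_le_norm g x).trans (by gcongr)
  calc _ ≤ ‖((∑ i, b i ^ 2 - m) * ⟪θ, x⟫) • θ‖ + ‖(r * ⟪θ, x⟫) • g‖ + ‖(r * ⟪g, x⟫) • θ‖ +
        ‖r ^ 2 • (∑ i, ⟪S i, x⟫ • S i - (l : ℝ) • x)‖ := norm_add₄_le
    _ ≤ D * (‖θ‖ * ‖x‖) * ‖θ‖ + r * (‖θ‖ * ‖x‖) * G + r * (G * ‖x‖) * ‖θ‖ +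
        r ^ 2 * (K * ‖x‖) := by
      simp only [norm_smul, Real.norm_eq_abs, abs_mul, abs_of_nonneg hr,
        abs_of_nonneg (sq_nonneg r)]
      have hD0 : 0 ≤ D := (abs_nonneg _).trans hD
      gcongr
      exact hK x
    _ = _ := by ring

/-- The loss of the spectral estimator, given a bound for the perturbation of the sample
covariance. -/
lemma loss_thetaHat_le {θ : EuclideanSpace ℝ (Fin d)} (hθ : θ ≠ 0) {m ε : ℝ} (hm : 0 < m)
    (hl : 1 ≤ l) (hε : 0 ≤ ε)
    {vmax : Matrix (Fin d) (Fin d) ℝ → EuclideanSpace ℝ (Fin d)} (hv : IsTopEigenvectorMap vmax)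
    (y : Fin n → EuclideanSpace ℝ (Fin d))
    (hE : ∀ x, ‖Matrix.toEuclideanLin (sampleCov k l y) x - (1 / (k : ℝ)) • x -
      (m / l * ⟪θ, x⟫) • θ‖ ≤ ε * ‖x‖) :
    loss (thetaHat vmax k l m y) θ ≤ 10 * ε / (m / l * ‖θ‖) := by
  have hl' : (0 : ℝ) < l := by exact_mod_cast hl
  obtain ⟨hv1, hv2⟩ := hv _ (isSymm_sampleCov (k := k) (l := l) y)
  have ht : 0 < ‖θ‖ := norm_pos_iff.2 hθ
  rw [loss, thetaHat, ← one_div_div]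
  refine min_norm_sub_norm_add_le (by positivity) hθ hv1 hε ?_ ?_
  · have := hE (vmax (sampleCov k l y))
    rwa [hv2, ← sub_smul, hv1, mul_one] at this
  · have h1 := inner_toEuclideanLin_le_lambdaMax (isSymm_sampleCov (k := k) (l := l) y) θ
    have h2 := (abs_real_inner_le_norm θ _).trans
      (mul_le_mul_of_nonneg_left (hE θ) (norm_nonneg θ))
    rw [inner_sub_right, inner_sub_right, real_inner_smul_right, real_inner_smul_right,
      real_inner_self_eq_norm_sq] at h2
    have h3 := (abs_le.1 h2).1
    have h4 : (m / l * ‖θ‖ ^ 2 - ε) * ‖θ‖ ^ 2 ≤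
        (lambdaMax (sampleCov k l y) - 1 / k) * ‖θ‖ ^ 2 := by
      linarith
    exact le_of_mul_le_mul_right h4 (by positivity)

variable {Ω : Type*} [MeasurableSpace Ω] {μ : Measure Ω} {δ : ℝ}
  {θ : EuclideanSpace ℝ (Fin d)} {η : Fin n → Ω → ℝ}
  {ξ Y : Fin n → Ω → EuclideanSpace ℝ (Fin d)}

/-- Energy, cross term and covariance contribute `2 + 1 + 1` tails. Passing from the norming set to
all directions costs a factor `2` for the vector (`4` becomes `8`) and `4` for the operator (`80`
becomes `320`). -/
lemma IsModel.measure_bad_event_le [IsProbabilityMeasure μ] (h : IsModel μ δ θ η ξ Y) (hδ : 0 < δ) (hd : 1 ≤ d)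
    (hn : n = k * l) (hk : 1 ≤ k) (hl : 1 ≤ l) :
    μ.real {ω | ¬ (|∑ i : Fin l, bucketMean k (fun j => η j ω) i ^ 2 - expectedEnergy μ k l η| ≤
        √((d : ℝ) * l) ∧
      ‖∑ i : Fin l, bucketMean k (fun j => η j ω) i • bucketSum k (fun j => ξ j ω) i‖ ≤
        8 * √((d : ℝ) * l) ∧
      ∀ x, ‖∑ i : Fin l, ⟪bucketSum k (fun j => ξ j ω) i, x⟫ • bucketSum k (fun j => ξ j ω) i -
        (l : ℝ) • x‖ ≤ 320 * (√((d : ℝ) * l) + d) * ‖x‖)} ≤ 4 * Real.exp (-2 * d) := by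
  obtain ⟨N, hcard, hN, hnorm⟩ := exists_norming_finset hd
  have hA := h.chain.measure_energy_deviation_le hδ hn hk hl d
  have hB := h.noise.measure_exists_weighted_sum_le hn hk hl (A := fun i ω =>
    bucketMean k (fun j => η j ω) i) h.chain.measurable_bucketMean
    (h.chain.abs_bucketMean_le hn hk)
    (h.indep.comp (φ := fun z i => bucketMean k z i) (ψ := id) (by unfold bucketMean; fun_prop)
      measurable_id) hN hcard
  have hC := h.noise.measure_exists_covariance_le hn hk hN hcard
  calc _ ≤ _ := measureReal_mono (fun ω hω => ?_) (by finiteness)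
    _ ≤ _ := (measureReal_union_le _ _).trans
      (add_le_add ((measureReal_union_le _ _).trans (add_le_add hA hB)) hC)
    _ = _ := by ring
  by_contra hcon
  simp only [Set.mem_union, Set.mem_ofPred_eq, not_or, not_exists, not_and, not_le] at hcon
  obtain ⟨⟨h1, h2⟩, h3⟩ := hcon
  refine hω ⟨h1.le, ?_, ?_⟩
  · obtain ⟨y, hy, hle⟩ := hnorm
      (∑ i : Fin l, bucketMean k (fun j => η j ω) i • bucketSum k (fun j => ξ j ω) i)
    have := h2 y hy
    linarith
  · intro x
    have := norm_apply_le_of_norming hnorm (M := 80 * (√((d : ℝ) * l) + d)) (F := fun x =>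
      ∑ i : Fin l, ⟪bucketSum k (fun j => ξ j ω) i, x⟫ • bucketSum k (fun j => ξ j ω) i -
        (l : ℝ) • x) ?_ ?_ x
    · refine this.trans_eq (by ring)
    · intro x y
      simp only [inner_sub_left, inner_sub_right, sum_inner, inner_sum, real_inner_smul_left,
        real_inner_smul_right]
      congr 1
      refine Finset.sum_congr rfl fun i _ => ?_
      rw [real_inner_comm x]
      ring
    · intro x hx y hy
      refine (le_of_eq ?_).trans (h3 x hx y hy).le
      simp only [inner_sub_left, sum_inner, real_inner_smul_left, Finset.sum_sub_distrib,
        Finset.sum_const, Finset.card_univ, Fintype.card_fin, nsmul_eq_mul]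
      congr 1
      refine Finset.sum_congr rfl fun i _ => ?_
      rw [real_inner_comm x, real_inner_comm y]

lemma IsModel.bucketMean_obs (h : IsModel μ δ θ η ξ Y) (i : Fin l) (ω : Ω) :
    bucketMean k (fun j => Y j ω) i = bucketMean k (fun j => η j ω) i • θ +
      (√(k : ℝ))⁻¹ • bucketSum k (fun j => ξ j ω) i := by
  rw [← bucketMean_eq_bucketSum]
  simp only [bucketMean, h.obs, Finset.sum_add_distrib, smul_add, ← Finset.sum_smul, smul_smul,
    smul_eq_mul]

/-- The energy deviation `D` stays free: `√(dl)` serves the weak signal case and `0` the strong one.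
-/
lemma IsModel.loss_le (h : IsModel μ δ θ η ξ Y) (hθ : θ ≠ 0) (hn : n = k * l)
    (hk : 1 ≤ k) (hl : 1 ≤ l) {vmax : Matrix (Fin d) (Fin d) ℝ → EuclideanSpace ℝ (Fin d)}
    (hv : IsTopEigenvectorMap vmax) {m D : ℝ} (hm : 0 < m) (ω : Ω)
    (h₁ : |∑ i : Fin l, bucketMean k (fun j => η j ω) i ^ 2 - m| ≤ D)
    (h₂ : ‖∑ i : Fin l, bucketMean k (fun j => η j ω) i • bucketSum k (fun j => ξ j ω) i‖ ≤
        8 * √((d : ℝ) * l))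
    (h₃ : ∀ x, ‖∑ i : Fin l, ⟪bucketSum k (fun j => ξ j ω) i, x⟫ •
      bucketSum k (fun j => ξ j ω) i - (l : ℝ) • x‖ ≤ 320 * (√((d : ℝ) * l) + d) * ‖x‖) :
    loss (thetaHat vmax k l m (fun i => Y i ω)) θ ≤ 10 * (l / m * (D / l * ‖θ‖ +
      16 * √((d : ℝ) / n) + 320 / ‖θ‖ * (√((d : ℝ) / (k * n)) + (d : ℝ) / n))) := by
  have hl' : (0 : ℝ) < l := by exact_mod_cast hl
  have hk' : (0 : ℝ) < k := by exact_mod_cast hk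
  have hn' : (n : ℝ) = k * l := by exact_mod_cast hn
  have ht : 0 < ‖θ‖ := norm_pos_iff.2 hθ
  have hD : 0 ≤ D := (abs_nonneg _).trans h₁
  set r := (√(k : ℝ))⁻¹ with hr
  have hr0 : 0 ≤ r := by positivity
  have hr2 : r ^ 2 = 1 / k := by rw [hr, inv_pow, Real.sq_sqrt hk'.le, one_div]
  have h4 := loss_thetaHat_le hθ hm hl (k := k)
    (ε := 1 / l * (D * ‖θ‖ ^ 2 + 2 * r * ‖θ‖ * (8 * √((d : ℝ) * l)) +
      r ^ 2 * (320 * (√((d : ℝ) * l) + d)))) (by positivity) hv (fun i => Y i ω) fun x => by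
    rw [toEuclideanLin_sampleCov, ← hr2]
    simp only [h.bucketMean_obs]
    exact norm_secondMoment_sub_le hl hr0 h₁ h₂ h₃ x
  refine h4.trans_eq ?_
  have e1 : √((d : ℝ) / n) = r * √((d : ℝ) * l) / l := by
    rw [hn', hr, show (d : ℝ) / (k * l) = d * l / (k * l ^ 2) by field_simp,
      Real.sqrt_div (by positivity), Real.sqrt_mul hk'.le, Real.sqrt_sq hl'.le]
    field_simp
  have e2 : √((d : ℝ) / (k * n)) = r ^ 2 * √((d : ℝ) * l) / l := by
    rw [hn', hr2, show (d : ℝ) / (k * (k * l)) = d * l / (k * l) ^ 2 by field_simp,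
      Real.sqrt_div (by positivity), Real.sqrt_sq (by positivity)]
    field_simp
  have e3 : (d : ℝ) / n = r ^ 2 * d / l := by
    rw [hn', hr2]; field_simp
  rw [e1, e2, e3]
  field_simp
  ring

end Estimator

end HiddenMarkovMixture

/-! ### The main theorem -/

theorem theorem1 :
    ∃ c₀ c₁ C : ℝ, 0 < c₀ ∧ 0 < c₁ ∧ 0 < C ∧
      ∀ (d n k l : ℕ), 1 ≤ d → 1 ≤ k → 1 ≤ l → n = k * l →
      ∀ δ : ℝ, 0 < δ → δ < 1 / 2 →
      ∀ (Ω : Type*) [MeasurableSpace Ω] (μ : Measure Ω) [IsProbabilityMeasure μ]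
        (θ : EuclideanSpace ℝ (Fin d)) (η : Fin n → Ω → ℝ)
        (ξ Y : Fin n → Ω → EuclideanSpace ℝ (Fin d)),
        HiddenMarkovMixture.IsModel μ δ θ η ξ Y →
      ∀ vmax : Matrix (Fin d) (Fin d) ℝ → EuclideanSpace ℝ (Fin d),
        HiddenMarkovMixture.IsTopEigenvectorMap vmax →
        -- the case of a weak signal: any number of buckets
        (θ ≠ 0 → ‖θ‖ ^ 2 ≤ 1 →
          μ.real {ω | ¬ HiddenMarkovMixture.loss
              (HiddenMarkovMixture.thetaHat vmax k l
                (HiddenMarkovMixture.expectedEnergy μ k l η) (fun i => Y i ω)) θ ≤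
            C * ((l : ℝ) / HiddenMarkovMixture.expectedEnergy μ k l η *
              (√((d : ℝ) / l) * ‖θ‖ + √((d : ℝ) / n) +
                1 / ‖θ‖ * (√((d : ℝ) / (k * n)) + (d : ℝ) / n)))} ≤
            c₁ * Real.exp (-c₀ * d)) ∧
        -- the case of a strong signal: as many buckets as observations
        (1 ≤ ‖θ‖ ^ 2 → l = n →
          μ.real {ω | ¬ HiddenMarkovMixture.loss
              (HiddenMarkovMixture.thetaHat vmax k l
                (HiddenMarkovMixture.expectedEnergy μ k l η) (fun i => Y i ω)) θ ≤
            C * (√((d : ℝ) / n) + (d : ℝ) / n)} ≤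
            c₁ * Real.exp (-c₀ * d)) := by
  -- The first two constants come from the bad event. The third is `10 · (16 + 320)`, needed for
  -- `√(d/n)` in the strong case, where the cross and noise terms merge; the weak case needs only
  -- `3200`.
  refine ⟨2, 4, 3360, by norm_num, by norm_num, by norm_num, ?_⟩
  intro d n k l hd hk hl hn δ hδ hδ2 Ω _ μ _ θ η ξ Y h vmax hv
  have hl' : (0 : ℝ) < l := by exact_mod_cast hl
  refine ⟨fun hθ _ => ?_, fun hθ hln => ?_⟩
  -- Failure is contained in the bad event, and monotonicity needs no measurability, so the choice
  -- of eigenvector is arbitrary.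
  · refine le_trans (measureReal_mono ?_ (by finiteness))
      (h.measure_bad_event_le hδ hd hn hk hl)
    refine fun ω hω hgood => hω ?_
    obtain ⟨h₁, h₂, h₃⟩ := hgood
    have hm := h.chain.expectedEnergy_pos hδ (by linarith) hn hk hl
    have ht : 0 < ‖θ‖ := norm_pos_iff.2 hθ
    refine (h.loss_le hθ hn hk hl hv hm ω h₁ h₂ h₃).trans ?_
    have e : √((d : ℝ) * l) / l = √((d : ℝ) / l) := by
      rw [show (d : ℝ) / l = d * l / l ^ 2 by field_simp, Real.sqrt_div (by positivity),
        Real.sqrt_sq hl'.le]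
    rw [e, mul_left_comm, mul_left_comm (3360 : ℝ)]
    refine mul_le_mul_of_nonneg_left ?_ (by positivity)
    have p1 : 0 ≤ √((d : ℝ) / l) * ‖θ‖ := by positivity
    have p2 : 0 ≤ √((d : ℝ) / n) := by positivity
    have p3 : 0 ≤ 1 / ‖θ‖ * (√((d : ℝ) / (k * n)) + (d : ℝ) / n) := by positivity
    have p4 : 320 / ‖θ‖ * (√((d : ℝ) / (k * n)) + (d : ℝ) / n) =
        320 * (1 / ‖θ‖ * (√((d : ℝ) / (k * n)) + (d : ℝ) / n)) := by ring
    rw [p4]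
    linarith
  · obtain rfl : k = 1 := by
      have : k * l = 1 * l := by omega
      exact Nat.eq_of_mul_eq_mul_right hl this
    have hE : HiddenMarkovMixture.expectedEnergy μ 1 l η = l := h.chain.expectedEnergy_one hln.symm
    refine le_trans (measureReal_mono ?_ (by finiteness))
      (h.measure_bad_event_le hδ hd hn hk hl)
    refine fun ω hω hgood => hω ?_
    obtain ⟨-, h₂, h₃⟩ := hgood
    have ht : 1 ≤ ‖θ‖ := by
      rw [← one_pow 2] at hθ
      exact le_of_sq_le_sq hθ (norm_nonneg θ)
    -- With `k = 1` the energy equals `l` surely, so `D = 0`.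
    have h₁ : |∑ i : Fin l, HiddenMarkovMixture.bucketMean 1 (fun j => η j ω) i ^ 2 - l| ≤ 0 := by
      rw [h.chain.sum_bucketMean_one_sq hln.symm]; simp
    rw [hE]
    refine (h.loss_le (norm_pos_iff.1 (by linarith)) hn hk hl hv hl' ω h₁ h₂ h₃).trans ?_
    rw [div_self hl'.ne', one_mul, zero_div, zero_mul, zero_add, Nat.cast_one, one_mul]
    have p1 : 320 / ‖θ‖ ≤ 320 := div_le_self (by norm_num) ht
    have p2 : 0 ≤ √((d : ℝ) / n) := by positivity
    have p3 : 0 ≤ (d : ℝ) / n := by positivity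
    have p4 := mul_le_mul_of_nonneg_right p1 (add_nonneg p2 p3)
    linarith
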